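/- Let $q$ be an odd prime. Put $f_q(n)=1$ if $q\nmid\varphi(n)$ and $f_q(n)=0$ otherwise, and define $\Lambda_{f_q}$ by the formal Dirichlet series identity $-L_{f_q}'(s)/L_{f_q}(s)=\sum_{n\ge1}\Lambda_{f_q}(n)n^{-s}$, where $L_{f_q}(s)=\sum_{n\ge 1}f_q(n)n^{-s}$. Let $K(q)=\mathbb{Q}(\zeta_q)$, and let $\mathcal{EK}_{K(q)}=\gamma_{K(q)}/\alpha_{K(q)}$ be its Euler–Kronecker constant, where $\zeta_{K(q)}(s)=\frac{\alpha_{K(q)}}{s-1}+\gamma_{K(q)}+O(s-1)$ is the Laurent expansion at $s=1$ (with $\alpha_{K(q)}\ne0$) of the Dedekind zeta function. For a prime $p\neq q$ let $f_p$ be the least positive integer with $p^{f_p}\equiv1\pmod q$. Let $\gamma$ be Euler's constant. Then there is a real constant $B_{f_q}$ such that, as $x\to\infty$, $$\sum_{n\le x}\frac{\Lambda_{f_q}(n)}{n}=\frac{q-2}{q-1}\log x+B_{f_q}+o(1),$$ and $$B_{f_q}=\frac{(3-q)\log q}{(q-1)(q^2-1)}-\gamma+\frac{\mathcal{EK}_{K(q)}}{q-1}+\sum_{p\ne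 q,\ p\not\equiv1\,(\mathrm{mod}\ q)}\frac{\log p}{p^{f_p}-1},$$ where the sum over primes $p$ converges. Moreover, for every primitive root $g$ modulo $q$, with $\chi_g$ the Dirichlet character modulo $q$ given by $\chi_g(g^j)=e^{2\pi i j/(q-1)}$, $$B_{f_q}=\frac{(3-q)\log q}{(q-1)(q^2-1)}-\frac{q-2}{q-1}\gamma+\frac1{q-1}\sum_{k=1}^{q-2}\frac{L'(1,\chi_g^k)}{L(1,\chi_g^k)}+\sum_{p\ne q,\ p\not\equiv1\,(\mathrm{mod}\ q)}\frac{\log p}{p^{f_p}-1}.$$ -/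

import Mathlib

open Filter Topology

/-- The generalized von Mangoldt function `Λ_f` attached to an arithmetic function `f` with
`f 1 ≠ 0`: the coefficients of the formal Dirichlet series `-L_f' / L_f`, where
`L_f(s) = ∑ f(n) n ^ (-s)`, so that `-L_f'` has coefficients `f(n) log n`.  Here `Ring.inverse f` is
the inverse of `f` under Dirichlet convolution. -/
noncomputable def vonMangoldtOf (f : ArithmeticFunction ℝ) : ArithmeticFunction ℝ :=
  f.pmul ArithmeticFunction.log * Ring.inverse f

/-- `Λ_f` satisfies `Λ_f * f = f · log` (Dirichlet convolution) as soon as `f 1 = 1`. -/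
theorem vonMangoldtOf_mul_self (f : ArithmeticFunction ℝ) (hf : f 1 = 1) :
    vonMangoldtOf f * f = f.pmul ArithmeticFunction.log := by
  have hu : IsUnit f := by
    rw [ArithmeticFunction.isUnit_iff_isUnit_apply_one, hf]
    exact isUnit_one
  rw [vonMangoldtOf, mul_assoc, Ring.inverse_mul_cancel f hu, mul_one]

/-- The function `f_q`, with `f_q(n) = 1` if `q ∤ φ(n)` and `f_q(n) = 0` otherwise
(at `n = 0` it is `0`, in accordance with `q ∣ φ(0) = 0`). -/
def totientIndicator (q : ℕ) : ArithmeticFunction ℝ where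
  toFun n := if q ∣ Nat.totient n then 0 else 1
  map_zero' := by simp

/-- The sum `∑_{n ≤ x} Λ_{f_q}(n) / n`. -/
noncomputable def vonMangoldtSum (q : ℕ) (x : ℝ) : ℝ :=
  ∑ n ∈ Finset.Icc 1 ⌊x⌋₊, vonMangoldtOf (totientIndicator q) n / n

/-- The Laurent expansion of `ζ_K` at `s = 1` has a simple pole with residue `α`, and constant
term `γ`: with a function `g` analytic at `1` and `g 1 = γ`, one has `ζ_K(s) = α / (s - 1) + g(s)`
for all `s` near `1` with `Re s > 1`, the half plane where `ζ_K` is given by its Dirichlet series.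
(So the right-hand side is the analytic continuation of `ζ_K` to a punctured neighbourhood
of `1`.) -/
def HasZetaLaurentAtOne (K : Type*) [Field K] [NumberField K] (α γ : ℝ) : Prop :=
  α ≠ 0 ∧ ∃ g : ℂ → ℂ, AnalyticAt ℂ g 1 ∧ g 1 = (γ : ℂ) ∧
    ∀ᶠ s in 𝓝[{s : ℂ | 1 < s.re}] 1,
      NumberField.dedekindZeta K s = (α : ℂ) / (s - 1) + g s

/-- `c` is the Euler–Kronecker constant `γ_K / α_K` of `K`. -/
def IsEulerKronecker (K : Type*) [Field K] [NumberField K] (c : ℝ) : Prop :=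
  ∃ α γ : ℝ, HasZetaLaurentAtOne K α γ ∧ c = γ / α

/-- The Laurent data at `1`, hence the Euler–Kronecker constant, are unique. -/
theorem IsEulerKronecker.unique {K : Type*} [Field K] [NumberField K] {c d : ℝ}
    (hc : IsEulerKronecker K c) (hd : IsEulerKronecker K d) : c = d := by
  obtain ⟨α, γ, ⟨-, g, hg, hg1, hge⟩, rfl⟩ := hc
  obtain ⟨β, δ, ⟨-, h, hh, hh1, hhe⟩, rfl⟩ := hd
  have hne : (𝓝[{s : ℂ | 1 < s.re}] (1 : ℂ)).NeBot := by
    rw [← mem_closure_iff_nhdsWithin_neBot, Complex.closure_setOfPred_lt_re]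
    simp
  have hle : 𝓝[{s : ℂ | 1 < s.re}] (1 : ℂ) ≤ 𝓝 1 := nhdsWithin_le_nhds
  have hgl : Tendsto g (𝓝[{s : ℂ | 1 < s.re}] 1) (𝓝 (γ : ℂ)) :=
    hg1 ▸ hg.continuousAt.tendsto.mono_left hle
  have hhl : Tendsto h (𝓝[{s : ℂ | 1 < s.re}] 1) (𝓝 (δ : ℂ)) :=
    hh1 ▸ hh.continuousAt.tendsto.mono_left hle
  have hs : Tendsto (fun s : ℂ => s - 1) (𝓝[{s : ℂ | 1 < s.re}] 1) (𝓝 0) := by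
    have : Tendsto (fun s : ℂ => s - 1) (𝓝 1) (𝓝 (1 - 1)) :=
      (continuous_id.sub continuous_const).tendsto 1
    simpa using this.mono_left hle
  have hmem : ∀ᶠ s : ℂ in 𝓝[{s : ℂ | 1 < s.re}] 1, s - 1 ≠ 0 := by
    filter_upwards [self_mem_nhdsWithin] with s hs h0
    have h1 : s = 1 := sub_eq_zero.mp h0
    simp [h1] at hs
  have hab : (α : ℂ) = β := by
    have h1 : Tendsto (fun s : ℂ => (α : ℂ) - β) (𝓝[{s : ℂ | 1 < s.re}] 1) (𝓝 0) := by
      have h2 : Tendsto (fun s : ℂ => (s - 1) * (h s - g s)) (𝓝[{s : ℂ | 1 < s.re}] 1) (𝓝 0) := by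
        simpa using hs.mul (hhl.sub hgl)
      refine h2.congr' ?_
      filter_upwards [hge, hhe, hmem] with s e1 e2 e3
      rw [e1] at e2
      field_simp at e2
      linear_combination -e2
    exact sub_eq_zero.mp (tendsto_nhds_unique tendsto_const_nhds h1)
  have hgd : (γ : ℂ) = δ := by
    refine tendsto_nhds_unique (hgl.congr' ?_) hhl
    filter_upwards [hge, hhe] with s e1 e2
    rw [e1, hab] at e2
    exact add_left_cancel e2
  rw [Complex.ofReal_inj.mp hab, Complex.ofReal_inj.mp hgd]

/-- For a prime `q` and a primitive root `g` modulo `q`, the character `χ_g` modulo `q`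
with `χ_g(g ^ j) = ω ^ j`, where `ω = exp (2 π i / (q - 1))`. -/
noncomputable def primitiveRootChar (q : ℕ) [Fact q.Prime] (g : (ZMod q)ˣ)
    (hg : ∀ x, x ∈ Subgroup.zpowers g) : DirichletCharacter ℂ q :=
  MulChar.ofRootOfUnity
    (ζ := Units.mk0 (Complex.exp (2 * Real.pi * Complex.I / ((q : ℂ) - 1))) (Complex.exp_ne_zero _))
    (by
      have hq : 1 < q := (Fact.out : q.Prime).one_lt
      have hq' : ((q : ℂ) - 1) ≠ 0 := by
        rw [sub_ne_zero]
        exact_mod_cast hq.ne'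
      rw [mem_rootsOfUnity, ZMod.card_units, Units.ext_iff]
      simp only [Units.val_pow_eq_pow_val, Units.val_mk0, Units.val_one]
      rw [← Complex.exp_nat_mul, Nat.cast_sub hq.le, Nat.cast_one,
        mul_div_cancel₀ _ hq', Complex.exp_two_pi_mul_I])
    hg

/-- The primes `p ≠ q` with `p ≢ 1 (mod q)`. -/
abbrev NonSplitPrime (q : ℕ) : Type :=
  {p : ℕ // p.Prime ∧ p ≠ q ∧ ¬ p ≡ 1 [MOD q]}

/-- The summand `log p / (p ^ f_p - 1)`, where `f_p` is the multiplicative order of `p`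
modulo `q`. -/
noncomputable def primeTerm (q p : ℕ) : ℝ :=
  Real.log p / ((p : ℝ) ^ orderOf (p : ZMod q) - 1)

/-!
Write `f` for `totientIndicator q` and `K` for the cyclotomic field of conductor `q`. An integer
`n` with `q ∤ n` has `q ∤ φ(n)` exactly when no prime factor of `n` is `≡ 1 (mod q)`, and one
factor `q` may be added freely. Hence `f = u * e` (`totientIndicator_eq_mul`), where `u` is the
completely multiplicative indicator of the integers composed of primes `p ≠ q`,
`p ≢ 1 (mod q)`, and `e` has Dirichlet series `1 + q⁻ˢ`. Taking logarithmic derivatives,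
`Λ_f = u Λ` plus a function supported on the powers of `q`
(`vonMangoldtOf_totientIndicator`), and `u Λ` agrees with `Λ` on the residue classes other
than `0` and `1`, while on the class `1` it lives on the powers `p ^ k` with `f_p ∣ k`. The powers
of `q` contribute `log q / (q + 1)` and the class `1` contributes
`∑ log p / (p ^ f_p - 1)`, both by geometric series.

The remaining sums of `Λ(n) / n` over a reduced residue class `a` require the prime number theorem
in arithmetic progressions, in the form
`∑ Λ(n) / n = log x / φ(q) + c_a + o(1)` with `c_a` the value at `1` of the regular part of the
Dirichlet series (`tendsto_sum_residueClass_div`). It follows from the nonvanishing of `L(s, χ)` on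
`Re s = 1` by a Tauberian theorem (`tendsto_summatory_div_sub_log`), proved in two steps.

* A function `H` with a Lipschitz bound whose Laplace transform extends continuously to `0 ≤ Re z`
  tends to zero (`tendsto_zero_of_laplace`): smoothing `H` by the Fourier transform of a compactly
  supported function gives something that tends to zero by the Riemann–Lebesgue lemma, and the
  smoothing error is proportional to the Lipschitz constant, which rescaling makes arbitrarily
  small.
* This applies to the Riesz means `∑_{n ≤ x} a(n) (1/n - 1/x)`, which are Lipschitz in `log x` by
  Chebyshev's bound; their increments give `∑_{n ≤ x} a(n) ∼ δ x` by nonnegativity, and the two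
  statements add up to the asymptotics of `∑_{n ≤ x} a(n) / n`.

By orthogonality the constants `c_a`, `a ≠ 0, 1`, add up to an expression in `γ`, `log q` and the
sum of `L'/L(1, χ)` over the nontrivial characters (`sum_LFunctionResidueClassAux_one`), which are
the powers of `χ_g` (`sumLogDerivOne_eq_sum_pow`).

Finally, `-ζ_K' / ζ_K` has coefficients `∑ log N(P)` over the prime powers `P ^ k` of norm `n`, by
unique factorization of ideals (`log_mul_card_idealsOfNorm`). The splitting law in `K` identifies
them with `∑_χ χ(n) Λ(n)`, the principal character being taken modulo `1`
(`idealVonMangoldt_eq_sum`). So `(s - 1) ζ_K(s)` and the entire function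
`(s - 1) ζ(s) ∏_{χ ≠ 1} L(s, χ)` have the same logarithmic derivative, hence a constant quotient,
and the Euler–Kronecker constant of `K` is the logarithmic derivative of the latter at `s = 1`, that
is `γ + ∑_{χ ≠ 1} L'/L(1, χ)` (`isEulerKronecker_cyclotomic`).
-/

/-! ### A Tauberian theorem for the Laplace transform -/

open MeasureTheory in
theorem integrableOn_mul_exp_of_linear_growth {F : ℝ → ℂ} {C : ℝ} {z : ℂ}
    (hm : AEStronglyMeasurable F volume) (hC : ∀ t, 0 ≤ t → ‖F t‖ ≤ C * (1 + |t|))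
    (hz : 0 < z.re) : IntegrableOn (fun t : ℝ => F t * Complex.exp (-z * t)) (Set.Ici 0) := by
  have hi : IntegrableOn (fun t : ℝ => C * (1 + 2 / z.re) * Real.exp (-(z.re / 2) * t))
      (Set.Ici 0) :=
    (integrableOn_Ici_iff_integrableOn_Ioi enorm_ne_top).2
      ((integrableOn_exp_mul_Ioi (by linarith) 0).const_mul _)
  refine Integrable.mono' hi (hm.restrict.mul (by fun_prop)) ?_
  filter_upwards [ae_restrict_mem measurableSet_Ici] with t ht
  replace ht : 0 ≤ t := ht
  have hC0 : 0 ≤ C := by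
    have := (norm_nonneg _).trans (hC 0 le_rfl)
    simpa using this
  rw [norm_mul, Complex.norm_exp]
  have e1 : (-z * t).re = -z.re * t := by simp
  rw [e1]
  -- `1 + t` is absorbed by half of the exponential decay
  have e2 : 1 + |t| ≤ (1 + 2 / z.re) * Real.exp (z.re / 2 * t) := by
    rw [abs_of_nonneg ht]
    have := Real.add_one_le_exp (z.re / 2 * t)
    have h1 : (1 + 2 / z.re) * (z.re / 2 * t + 1) = 1 + t + (z.re / 2 * t + 2 / z.re) := by
      field_simp; ring
    have h2 : (1 + 2 / z.re) * (z.re / 2 * t + 1) ≤ (1 + 2 / z.re) * Real.exp (z.re / 2 * t) := by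
      gcongr
    have h3 : 0 ≤ z.re / 2 * t + 2 / z.re := by positivity
    linarith
  have e3 : Real.exp (-(z.re / 2) * t) = Real.exp (z.re / 2 * t) * Real.exp (-z.re * t) := by
    rw [← Real.exp_add]; congr 1; ring
  calc ‖F t‖ * Real.exp (-z.re * t) ≤ C * (1 + |t|) * Real.exp (-z.re * t) := by
        gcongr; exact hC t ht
    _ ≤ C * ((1 + 2 / z.re) * Real.exp (z.re / 2 * t)) * Real.exp (-z.re * t) := by gcongr
    _ = _ := by rw [e3]; ring

open MeasureTheory SchwartzMap FourierTransform in
/-- If the Laplace transform `h` of a function `H` supported on `[0, ∞)` and of at most linear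
growth extends continuously to the closed half plane `0 ≤ Re z`, then the integral of `H` against
translates of the Fourier transform of a compactly supported Schwartz function tends to zero: up to
the factor `h` on the imaginary axis, it is again a Fourier integral. -/
theorem tendsto_integral_fourier_mul_of_laplace {H : ℝ → ℂ} {h : ℂ → ℂ} {C : ℝ}
    (hm : AEStronglyMeasurable H volume) (hC : ∀ t, ‖H t‖ ≤ C * (1 + |t|))
    (h0 : ∀ t < 0, H t = 0) (hh : ContinuousOn h {z | 0 ≤ z.re})
    (hL : ∀ z : ℂ, 0 < z.re → ∫ t : ℝ, H t * Complex.exp (-z * t) = h z)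
    (φ : 𝓢(ℝ, ℂ)) (hφ : HasCompactSupport φ) :
    Tendsto (fun T : ℝ => ∫ t : ℝ, (𝓕 (φ : ℝ → ℂ)) (t - T) * H t) atTop (𝓝 0) := by
  have hC0 : 0 ≤ C := by
    have := (norm_nonneg _).trans (hC 0)
    simpa using this
  obtain ⟨ψ, hF⟩ : ∃ ψ : 𝓢(ℝ, ℂ), 𝓕 (φ : ℝ → ℂ) = ψ := ⟨𝓕 φ, (SchwartzMap.fourier_coe φ).symm⟩
  have hint : ∀ ε : ℝ, 0 < ε → Integrable (fun t : ℝ => H t * Complex.exp (-ε * t)) := by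
    intro ε hε
    have := integrableOn_mul_exp_of_linear_growth hm (fun t _ => hC t) (z := ε) (by simpa using hε)
    refine (integrableOn_iff_integrable_of_support_subset fun t ht => ?_).1 this
    by_contra h
    exact ht (by simp [h0 t (not_le.1 h)])
  -- Parseval for the damped function
  have key1 : ∀ T ε : ℝ, 0 < ε →
      ∫ t : ℝ, (𝓕 (φ : ℝ → ℂ)) (t - T) * (H t * Complex.exp (-ε * t)) =
      ∫ y : ℝ, Complex.exp (2 * Real.pi * T * y * Complex.I) * φ y *
        h (ε + 2 * Real.pi * y * Complex.I) := by
    intro T ε hε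
    have hfi : Integrable (fun y : ℝ => Complex.exp (2 * Real.pi * T * y * Complex.I) * φ y) := by
      refine φ.integrable.mono (by fun_prop) (Eventually.of_forall fun y => ?_)
      rw [norm_mul, Complex.norm_exp]
      simp
    have := VectorFourier.integral_fourierIntegral_smul_eq_flip (L := innerₗ ℝ)
      Real.continuous_fourierChar continuous_inner hfi (hint ε hε)
    have e1 : ∀ t, VectorFourier.fourierIntegral Real.fourierChar volume (innerₗ ℝ)
        (fun y : ℝ => Complex.exp (2 * Real.pi * T * y * Complex.I) * φ y) t
        = (𝓕 (φ : ℝ → ℂ)) (t - T) := by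
      intro t
      change (𝓕 (fun y : ℝ => Complex.exp (2 * Real.pi * T * y * Complex.I) * φ y)) t = _
      rw [Real.fourier_real_eq_integral_exp_smul, Real.fourier_real_eq_integral_exp_smul]
      refine integral_congr_ae (Eventually.of_forall fun y => ?_)
      simp only [smul_eq_mul]
      rw [← mul_assoc, ← Complex.exp_add]
      congr 2
      push_cast
      ring
    have e2 : ∀ y, VectorFourier.fourierIntegral Real.fourierChar volume (innerₗ ℝ).flip
        (fun t : ℝ => H t * Complex.exp (-ε * t)) y = h (ε + 2 * Real.pi * y * Complex.I) := by
      intro y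
      rw [flip_innerₗ]
      change (𝓕 (fun t : ℝ => H t * Complex.exp (-ε * t))) y = _
      rw [Real.fourier_real_eq_integral_exp_smul, ← hL _ (by simpa using hε)]
      refine integral_congr_ae (Eventually.of_forall fun t => ?_)
      simp only [smul_eq_mul]
      rw [mul_left_comm, ← Complex.exp_add]
      congr 2
      push_cast
      ring
    simp only [e1, e2, smul_eq_mul] at this
    exact this
  -- removal of the damping
  have key2 : ∀ T : ℝ, ∫ t : ℝ, (𝓕 (φ : ℝ → ℂ)) (t - T) * H t =
      ∫ y : ℝ, Complex.exp (2 * Real.pi * T * y * Complex.I) * φ y *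
        h (2 * Real.pi * y * Complex.I) := by
    intro T
    have l1 : Tendsto (fun ε : ℝ => ∫ t : ℝ,
        (𝓕 (φ : ℝ → ℂ)) (t - T) * (H t * Complex.exp (-ε * t))) (𝓝[>] 0)
        (𝓝 (∫ t : ℝ, (𝓕 (φ : ℝ → ℂ)) (t - T) * H t)) := by
      refine tendsto_integral_filter_of_dominated_convergence
        (fun t => ‖ψ (t - T)‖ * (C * ((1 + |T|) * (1 + |t - T|)))) ?_ ?_ ?_ ?_
      · refine Eventually.of_forall fun ε => ?_
        rw [hF]
        exact ((by fun_prop : Continuous (fun t => ψ (t - T))).aestronglyMeasurable).mul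
          (hm.mul (by fun_prop))
      · filter_upwards [self_mem_nhdsWithin] with ε (hε : 0 < ε)
        refine Eventually.of_forall fun t => ?_
        rw [norm_mul, norm_mul, hF]
        refine mul_le_mul_of_nonneg_left ?_ (norm_nonneg _)
        by_cases ht : t < 0
        · rw [h0 t ht, norm_zero, zero_mul]; positivity
        · push Not at ht
          have e1 : ‖Complex.exp (-(ε : ℂ) * t)‖ ≤ 1 := by
            rw [Complex.norm_exp]
            simp only [Complex.mul_re, Complex.neg_re, Complex.ofReal_re, Complex.neg_im,
              Complex.ofReal_im, neg_zero, mul_zero, sub_zero, Real.exp_le_one_iff]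
            nlinarith
          have e2 : 1 + |t| ≤ (1 + |T|) * (1 + |t - T|) := by
            have : |t| ≤ |T| + |t - T| := by
              have := abs_add_le T (t - T); simpa using this
            nlinarith [abs_nonneg T, abs_nonneg (t - T)]
          calc ‖H t‖ * ‖Complex.exp (-(ε : ℂ) * t)‖ ≤ C * (1 + |t|) * 1 := by
                gcongr
                exact hC t
            _ ≤ _ := by rw [mul_one]; gcongr
      · have i1 := ψ.integrable_pow_mul volume 1
        have i0 := ψ.integrable.norm (μ := volume)
        have := ((i0.add i1).comp_sub_right T).const_mul (C * (1 + |T|))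
        refine this.congr (Eventually.of_forall fun t => ?_)
        simp only [Pi.add_apply, pow_one, Real.norm_eq_abs]
        ring
      · refine Eventually.of_forall fun t => ?_
        have : Tendsto (fun ε : ℝ => (𝓕 (φ : ℝ → ℂ)) (t - T) * (H t * Complex.exp (-ε * t)))
            (𝓝 0) (𝓝 ((𝓕 (φ : ℝ → ℂ)) (t - T) * (H t * Complex.exp (-(0 : ℝ) * t)))) := by
          apply Continuous.tendsto
          fun_prop
        simpa using this.mono_left nhdsWithin_le_nhds
    have l2 : Tendsto (fun ε : ℝ => ∫ y : ℝ, Complex.exp (2 * Real.pi * T * y * Complex.I) * φ y *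
        h (ε + 2 * Real.pi * y * Complex.I)) (𝓝[>] 0)
        (𝓝 (∫ y : ℝ, Complex.exp (2 * Real.pi * T * y * Complex.I) * φ y *
        h (2 * Real.pi * y * Complex.I))) := by
      have hcont : ∀ ε : ℝ, 0 ≤ ε → Continuous fun y : ℝ => h (ε + 2 * Real.pi * y * Complex.I) := by
        intro ε hε
        refine hh.comp_continuous (by fun_prop) fun y => ?_
        simpa using hε
      obtain ⟨K, hK⟩ : ∃ K, ∀ ε ∈ Set.Icc (0 : ℝ) 1, ∀ y ∈ tsupport φ,
          ‖h (ε + 2 * Real.pi * y * Complex.I)‖ ≤ K := by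
        have hc : IsCompact (Set.Icc (0 : ℝ) 1 ×ˢ tsupport φ) := isCompact_Icc.prod hφ
        have hcc : ContinuousOn (fun p : ℝ × ℝ => h (p.1 + 2 * Real.pi * p.2 * Complex.I))
            (Set.Icc (0 : ℝ) 1 ×ˢ tsupport φ) := by
          refine hh.comp (by fun_prop) fun p hp => ?_
          simpa using hp.1.1
        obtain ⟨K, hK⟩ := hc.exists_bound_of_continuousOn hcc
        exact ⟨K, fun ε hε y hy => hK (ε, y) ⟨hε, hy⟩⟩
      refine tendsto_integral_filter_of_dominated_convergence
        (fun y => ‖φ y‖ * K) ?_ ?_ ?_ ?_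
      · filter_upwards [self_mem_nhdsWithin] with ε (hε : 0 < ε)
        exact (Continuous.mul (by fun_prop) (hcont ε hε.le)).aestronglyMeasurable
      · filter_upwards [Ioc_mem_nhdsGT (zero_lt_one' ℝ)] with ε hε
        refine Eventually.of_forall fun y => ?_
        rw [norm_mul, norm_mul, Complex.norm_exp]
        by_cases hy : y ∈ tsupport φ
        · have := hK ε ⟨hε.1.le, hε.2⟩ y hy
          simp only [Complex.mul_re, Complex.re_ofNat, Complex.ofReal_re, Complex.im_ofNat,
            Complex.ofReal_im, mul_zero, sub_zero, Complex.mul_im, zero_mul, add_zero, Complex.I_re,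
            Complex.I_im, mul_one, sub_self, Real.exp_zero, one_mul]
          gcongr
        · rw [image_eq_zero_of_notMem_tsupport hy]
          simp
      · exact φ.integrable.norm.mul_const K
      · refine Eventually.of_forall fun y => ?_
        refine Tendsto.mul tendsto_const_nhds ?_
        have hz := hh (2 * Real.pi * y * Complex.I) (by simp)
        refine hz.tendsto.comp (tendsto_nhdsWithin_iff.2 ⟨?_, ?_⟩)
        · have : Tendsto (fun ε : ℝ => (ε : ℂ) + 2 * Real.pi * y * Complex.I) (𝓝 0)
              (𝓝 ((0 : ℝ) + 2 * Real.pi * y * Complex.I)) := by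
            apply Continuous.tendsto
            fun_prop
          simpa using this.mono_left nhdsWithin_le_nhds
        · filter_upwards [self_mem_nhdsWithin] with ε (hε : 0 < ε)
          simpa using hε.le
    refine tendsto_nhds_unique l1 (l2.congr' ?_)
    filter_upwards [self_mem_nhdsWithin] with ε (hε : 0 < ε)
    exact (key1 T ε hε).symm
  -- the Riemann–Lebesgue lemma
  have RL := (Real.tendsto_integral_exp_smul_cocompact
    (fun y : ℝ => φ y * h (2 * Real.pi * y * Complex.I))).comp
      (tendsto_neg_atTop_atBot.mono_right (atBot_le_cocompact (α := ℝ)))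
  refine RL.congr fun T => ?_
  rw [key2, Function.comp_apply]
  refine integral_congr_ae (Eventually.of_forall fun y => ?_)
  simp only [Circle.smul_def, smul_eq_mul, Real.fourierChar_apply]
  rw [← mul_assoc]
  congr 3
  push_cast
  ring

open SchwartzMap in
theorem exists_schwartzMap_hasCompactSupport_eq_one :
    ∃ φ : 𝓢(ℝ, ℂ), HasCompactSupport φ ∧ φ 0 = 1 := by
  obtain ⟨b, hb⟩ : ∃ b : ContDiffBump (0 : ℝ), 0 < b.rIn := ⟨⟨1, 2, one_pos, one_lt_two⟩, one_pos⟩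
  have hbs : HasCompactSupport (fun y => ((b : ℝ → ℝ) y : ℂ)) :=
    b.hasCompactSupport.comp_left (g := fun x : ℝ => (x : ℂ)) (by simp)
  have hbr : ContDiff ℝ ((⊤ : ℕ∞) : WithTop ℕ∞) (b : ℝ → ℝ) := b.contDiff
  have hbd : ContDiff ℝ ((⊤ : ℕ∞) : WithTop ℕ∞) (fun y => ((b : ℝ → ℝ) y : ℂ)) :=
    Complex.ofRealCLM.contDiff.comp hbr
  refine ⟨hbs.toSchwartzMap hbd, hbs, ?_⟩
  have : b 0 = 1 := b.one_of_mem_closedBall (by simp [hb.le])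
  change ((b : ℝ → ℝ) 0 : ℂ) = 1
  simp [this]

open MeasureTheory SchwartzMap FourierTransform in
/-- The kernel estimate behind the Tauberian theorem: a function with Lipschitz constant `C` (at
large base points) whose Laplace transform extends continuously to the closed half plane is
eventually `O(C)`, with an absolute constant. -/
theorem exists_eventually_norm_le_of_laplace : ∃ M : ℝ, ∀ (H : ℝ → ℂ) (h : ℂ → ℂ) (C : ℝ),
    AEStronglyMeasurable H volume → (∀ᶠ T in atTop, ∀ t, ‖H t - H T‖ ≤ C * |t - T|) →
    (∀ t < 0, H t = 0) → ContinuousOn h {z | 0 ≤ z.re} →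
    (∀ z : ℂ, 0 < z.re → ∫ t : ℝ, H t * Complex.exp (-z * t) = h z) →
    ∀ ε > 0, ∀ᶠ T in atTop, ‖H T‖ ≤ M * C + ε := by
  obtain ⟨φ, hφ, hφ0⟩ := exists_schwartzMap_hasCompactSupport_eq_one
  obtain ⟨ψ, hF⟩ : ∃ ψ : 𝓢(ℝ, ℂ), 𝓕 (φ : ℝ → ℂ) = ψ := ⟨𝓕 φ, (SchwartzMap.fourier_coe φ).symm⟩
  have hone : ∫ u, ψ u = 1 := by
    have hFi : Integrable (𝓕 (φ : ℝ → ℂ)) := by rw [hF]; exact ψ.integrable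
    have h1 := φ.integrable.fourierInv_fourier_eq hFi
      (φ.continuous.continuousAt (x := 0))
    rw [Real.fourierInv_eq' ] at h1
    simp only [inner_zero_right, mul_zero, Complex.ofReal_zero, zero_mul, Complex.exp_zero,
      one_smul] at h1
    rw [← hF, h1, hφ0]
  refine ⟨∫ u, ‖u‖ ^ 1 * ‖ψ u‖, fun H h C hm hlip h0 hh hL ε hε => ?_⟩
  obtain ⟨T₁, hT₁⟩ := hlip.exists
  have hgrow : ∀ t, ‖H t‖ ≤ (‖H T₁‖ + |C| * (1 + |T₁|)) * (1 + |t|) := by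
    intro t
    have h1 : ‖H t‖ ≤ ‖H T₁‖ + ‖H t - H T₁‖ := by
      have := norm_add_le (H T₁) (H t - H T₁); simpa using this
    have h2 : C * |t - T₁| ≤ |C| * (|t| + |T₁|) := by
      have : |t - T₁| ≤ |t| + |T₁| := abs_sub t T₁
      calc C * |t - T₁| ≤ |C| * |t - T₁| := by gcongr; exact le_abs_self C
        _ ≤ _ := by gcongr
    have h3 := hT₁ t
    nlinarith [abs_nonneg t, abs_nonneg C, abs_nonneg T₁, norm_nonneg (H T₁),
      mul_nonneg (norm_nonneg (H T₁)) (abs_nonneg t),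
      mul_nonneg (mul_nonneg (abs_nonneg C) (abs_nonneg T₁)) (abs_nonneg t)]
  have hlim := tendsto_integral_fourier_mul_of_laplace hm hgrow h0 hh hL φ hφ
  have hlim' := (tendsto_zero_iff_norm_tendsto_zero.1 hlim).eventually_lt_const hε
  filter_upwards [hlim', hlip] with T hT hTl
  rw [hF] at hT
  have i0 : Integrable (fun t => ψ (t - T)) := ψ.integrable.comp_sub_right T
  have i1 : Integrable (fun t => ‖t - T‖ ^ 1 * ‖ψ (t - T)‖) :=
    (ψ.integrable_pow_mul volume 1).comp_sub_right T
  have i2 : Integrable (fun t => ψ (t - T) * (H t - H T)) := by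
    refine (i1.const_mul C).mono' (i0.1.mul (hm.sub aestronglyMeasurable_const))
      (Eventually.of_forall fun t => ?_)
    rw [norm_mul, pow_one, Real.norm_eq_abs]
    have := mul_le_mul_of_nonneg_left (hTl t) (norm_nonneg (ψ (t - T)))
    linarith
  have e1 : ∫ t, ψ (t - T) * H t = (∫ t, ψ (t - T) * (H t - H T)) + H T := by
    have : ∀ t, ψ (t - T) * H t =
        ψ (t - T) * (H t - H T) + ψ (t - T) * H T := fun t => by ring
    simp_rw [this]
    rw [integral_add i2 (i0.mul_const _), integral_mul_const,
      integral_sub_right_eq_self (fun t => ψ t) T, hone, one_mul]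
  have e2 : ‖∫ t, ψ (t - T) * (H t - H T)‖ ≤ (∫ u, ‖u‖ ^ 1 * ‖ψ u‖) * C := by
    rw [← integral_sub_right_eq_self (fun u => ‖u‖ ^ 1 * ‖ψ u‖) T, ← integral_mul_const]
    refine norm_integral_le_of_norm_le (i1.mul_const C) (Eventually.of_forall fun t => ?_)
    rw [norm_mul, pow_one, Real.norm_eq_abs]
    have := mul_le_mul_of_nonneg_left (hTl t) (norm_nonneg (ψ (t - T)))
    linarith
  have e3 : H T = (∫ t, ψ (t - T) * H t) - ∫ t, ψ (t - T) * (H t - H T) := by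
    rw [e1]; ring
  rw [e3]
  refine (norm_sub_le _ _).trans ?_
  linarith

open MeasureTheory in
/-- **Tauberian theorem** for Lipschitz functions: if `H` is supported on `[0, ∞)` and its Laplace
transform extends continuously to the closed half plane `0 ≤ Re z`, then `H` tends to zero at
infinity. The Lipschitz bound is only required at large base points `T`, so that `H` may jump
at `0`. -/
theorem tendsto_zero_of_laplace {H : ℝ → ℂ} {h : ℂ → ℂ} {C : ℝ}
    (hm : AEStronglyMeasurable H volume) (hlip : ∀ᶠ T in atTop, ∀ t, ‖H t - H T‖ ≤ C * |t - T|)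
    (h0 : ∀ t < 0, H t = 0) (hh : ContinuousOn h {z | 0 ≤ z.re})
    (hL : ∀ z : ℂ, 0 < z.re → ∫ t : ℝ, H t * Complex.exp (-z * t) = h z) :
    Tendsto H atTop (𝓝 0) := by
  obtain ⟨M, hM⟩ := exists_eventually_norm_le_of_laplace
  -- rescaling the variable by `R` divides the Lipschitz constant by `R`
  have hR : ∀ R : ℝ, 0 < R → ∀ ε > 0, ∀ᶠ T in atTop, ‖H T‖ ≤ M * (C / R) + ε := by
    intro R hR ε hε
    have := hM (fun t => H (t / R)) (fun z => R * h (R * z)) (C / R) ?_ ?_ ?_ ?_ ?_ ε hε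
    · have h2 := (tendsto_id.atTop_mul_const hR).eventually this
      filter_upwards [h2] with T hT
      simpa [hR.ne'] using hT
    · have e : Measurable fun t : ℝ => t / R := by fun_prop
      have hq : Measure.QuasiMeasurePreserving (fun t : ℝ => t / R) volume volume := by
        refine ⟨e, ?_⟩
        simp_rw [div_eq_mul_inv]
        rw [Real.map_volume_mul_right (inv_ne_zero hR.ne')]
        exact Measure.smul_absolutelyContinuous
      exact hm.comp_quasiMeasurePreserving hq
    · have h2 := (tendsto_id.atTop_div_const hR).eventually hlip
      filter_upwards [h2] with T hT t
      refine (hT (t / R)).trans_eq ?_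
      rw [id, ← sub_div, abs_div, abs_of_pos hR]
      ring
    · intro t ht
      exact h0 _ (div_neg_of_neg_of_pos ht hR)
    · refine continuousOn_const.mul (hh.comp (by fun_prop) fun z hz => ?_)
      have : 0 ≤ z.re := hz
      simpa using by positivity
    · intro z hz
      have e := hL (R * z) (by simpa using by positivity)
      rw [← e]
      have := Measure.integral_comp_div (fun t : ℝ => H t * Complex.exp (-(R * z) * t)) R
      rw [abs_of_pos hR] at this
      simp only [Complex.real_smul] at this
      rw [← this]
      refine integral_congr_ae (Eventually.of_forall fun t => ?_)
      simp only
      congr 2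
      push_cast
      have : (R : ℂ) ≠ 0 := by exact_mod_cast hR.ne'
      field_simp
  rw [Metric.tendsto_nhds]
  intro ε hε
  obtain ⟨R, hR0, hR1⟩ : ∃ R : ℝ, 0 < R ∧ M * (C / R) ≤ ε / 4 := by
    refine ⟨4 * (|M * C| + 1) / ε, by positivity, ?_⟩
    have : M * (C / (4 * (|M * C| + 1) / ε)) = ε / 4 * (M * C / (|M * C| + 1)) := by
      field_simp
    rw [this]
    have h2 : M * C / (|M * C| + 1) ≤ 1 := by
      rw [div_le_one (by positivity)]
      linarith [le_abs_self (M * C)]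
    nlinarith
  filter_upwards [hR R hR0 (ε / 4) (by positivity)] with T hT
  rw [dist_zero_right]
  linarith

/-! ### A Tauberian theorem for Dirichlet series -/

section

open MeasureTheory

/-- The summatory function `∑_{1 ≤ n ≤ x} a(n)`. -/
noncomputable def summatory (a : ℕ → ℝ) (x : ℝ) : ℝ := ∑ k ∈ Finset.Icc 1 ⌊x⌋₊, a k

section summatory

variable {a : ℕ → ℝ}

theorem summatory_mono (ha : ∀ n, 0 ≤ a n) : Monotone (summatory a) := fun _ _ hxy =>
  Finset.sum_le_sum_of_subset_of_nonneg
    (Finset.Icc_subset_Icc_right (Nat.floor_le_floor hxy)) fun i _ _ => ha i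

theorem summatory_nonneg (ha : ∀ n, 0 ≤ a n) (x : ℝ) : 0 ≤ summatory a x :=
  Finset.sum_nonneg fun i _ => ha i

theorem summatory_le {C : ℝ} (hC0 : 0 ≤ C) (hC : ∀ n : ℕ, ∑ k ∈ Finset.Icc 1 n, a k ≤ C * n)
    {x : ℝ} (hx : 0 ≤ x) : summatory a x ≤ C * x :=
  (hC _).trans (mul_le_mul_of_nonneg_left (Nat.floor_le hx) hC0)

/-- The weighted average `∑_{n ≤ x} a(n) (1/n - 1/x)`; in contrast to `∑_{n ≤ x} a(n)/n`, it is a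
Lipschitz function of `log x` as soon as `∑_{n ≤ x} a(n) = O(x)`. -/
noncomputable def rieszMean (a : ℕ → ℝ) (x : ℝ) : ℝ :=
  summatory (fun n => a n / n) x - summatory a x / x

theorem integrableOn_summatory_div_sq (ha : ∀ n, 0 ≤ a n) {x y : ℝ} (hx : 0 < x) :
    IntegrableOn (fun t => summatory a t / t ^ 2) (Set.Icc x y) := by
  have h1 : IntegrableOn (summatory a) (Set.Icc x y) :=
    (summatory_mono ha).locallyIntegrable.integrableOn_isCompact isCompact_Icc
  simp_rw [div_eq_mul_inv]
  refine h1.mul_continuousOn ?_ isCompact_Icc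
  refine ContinuousOn.inv₀ (by fun_prop) fun t ht => ?_
  have : 0 < t := hx.trans_le ht.1
  positivity

theorem rieszMean_eq_integral (ha0 : a 0 = 0) (b : ℝ) (hb : 1 ≤ b) :
    rieszMean a b = ∫ t in (1)..b, summatory a t / t ^ 2 := by
  have hI : ∀ (f : ℕ → ℝ), f 0 = 0 → ∀ n,
      ∑ k ∈ Finset.Icc 0 n, f k = ∑ k ∈ Finset.Icc 1 n, f k := by
    intro f hf n
    rw [← Finset.insert_Icc_add_one_left_eq_Icc n.zero_le, Finset.sum_insert (by simp), hf,
      zero_add, zero_add]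
  have hdiff : ∀ t ∈ Set.Icc 1 b, DifferentiableAt ℝ (fun t : ℝ => t⁻¹) t := by
    intro t ht
    exact differentiableAt_inv (by have := ht.1; positivity)
  have := sum_mul_eq_sub_integral_mul₀ a (f := fun t : ℝ => t⁻¹) ha0 b hdiff ?_
  · rw [hI _ (by simp), hI _ ha0] at this
    have e1 : summatory (fun n => a n / n) b = ∑ k ∈ Finset.Icc 1 ⌊b⌋₊, (k : ℝ)⁻¹ * a k :=
      Finset.sum_congr rfl fun k _ => div_eq_inv_mul _ _
    rw [rieszMean, e1, this, intervalIntegral.integral_of_le hb]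
    have e2 : ∀ t : ℝ, deriv (fun t : ℝ => t⁻¹) t * ∑ k ∈ Finset.Icc 0 ⌊t⌋₊, a k =
        - (summatory a t / t ^ 2) := by
      intro t
      rw [hI _ ha0, deriv_inv, summatory]
      ring
    simp_rw [e2]
    rw [integral_neg, summatory]
    ring
  · have : deriv (fun t : ℝ => t⁻¹) = fun t => -(t ^ 2)⁻¹ := by
      funext t; exact deriv_inv
    rw [this]
    refine ContinuousOn.integrableOn_Icc ?_
    refine (ContinuousOn.inv₀ (by fun_prop) fun t ht => ?_).neg
    have : 0 < t := one_pos.trans_le ht.1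
    positivity

theorem rieszMean_sub_eq_integral (ha : ∀ n, 0 ≤ a n) (ha0 : a 0 = 0) {x y : ℝ} (hx : 1 ≤ x)
    (hxy : x ≤ y) : rieszMean a y - rieszMean a x = ∫ t in x..y, summatory a t / t ^ 2 := by
  have hi : ∀ u v : ℝ, 1 ≤ u → u ≤ v →
      IntervalIntegrable (fun t => summatory a t / t ^ 2) volume u v := by
    intro u v hu huv
    rw [intervalIntegrable_iff_integrableOn_Icc_of_le huv]
    exact integrableOn_summatory_div_sq ha (by linarith)
  rw [rieszMean_eq_integral ha0 x hx, rieszMean_eq_integral ha0 y (hx.trans hxy),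
    intervalIntegral.integral_interval_sub_left (hi _ _ le_rfl (hx.trans hxy)) (hi _ _ le_rfl hx)]

theorem integral_const_div_sq (c : ℝ) {x y : ℝ} (hx : 0 < x) (hxy : x ≤ y) :
    ∫ t in x..y, c / t ^ 2 = c * (1 / x - 1 / y) := by
  have h : ∀ t ∈ Set.uIcc x y, HasDerivAt (fun t : ℝ => -c * t⁻¹) (c / t ^ 2) t := by
    intro t ht
    rw [Set.uIcc_of_le hxy] at ht
    have ht0 : t ≠ 0 := (hx.trans_le ht.1).ne'
    refine ((hasDerivAt_inv ht0).const_mul (-c)).congr_deriv ?_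
    rw [div_eq_mul_inv]
    ring
  rw [intervalIntegral.integral_eq_sub_of_hasDerivAt h]
  · ring
  · apply ContinuousOn.intervalIntegrable
    rw [Set.uIcc_of_le hxy]
    refine ContinuousOn.div (by fun_prop) (by fun_prop) fun t ht => ?_
    have : 0 < t := hx.trans_le ht.1
    positivity

theorem intervalIntegrable_const_div_sq (c : ℝ) {x y : ℝ} (hx : 0 < x) (hxy : x ≤ y) :
    IntervalIntegrable (fun t : ℝ => c / t ^ 2) volume x y := by
  apply ContinuousOn.intervalIntegrable
  rw [Set.uIcc_of_le hxy]
  refine ContinuousOn.div (by fun_prop) (by fun_prop) fun t ht => ?_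
  have : 0 < t := hx.trans_le ht.1
  positivity

theorem intervalIntegrable_summatory_div_sq (ha : ∀ n, 0 ≤ a n) {x y : ℝ} (hx : 0 < x)
    (hxy : x ≤ y) : IntervalIntegrable (fun t => summatory a t / t ^ 2) volume x y := by
  rw [intervalIntegrable_iff_integrableOn_Icc_of_le hxy]
  exact integrableOn_summatory_div_sq ha hx

theorem le_rieszMean_sub (ha : ∀ n, 0 ≤ a n) (ha0 : a 0 = 0) {x y : ℝ} (hx : 1 ≤ x)
    (hxy : x ≤ y) : summatory a x * (1 / x - 1 / y) ≤ rieszMean a y - rieszMean a x := by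
  have hx0 : 0 < x := by linarith
  rw [rieszMean_sub_eq_integral ha ha0 hx hxy, ← integral_const_div_sq _ hx0 hxy]
  refine intervalIntegral.integral_mono_on hxy (intervalIntegrable_const_div_sq _ hx0 hxy)
    (intervalIntegrable_summatory_div_sq ha hx0 hxy) fun t ht => ?_
  gcongr
  exact summatory_mono ha ht.1

theorem rieszMean_sub_le (ha : ∀ n, 0 ≤ a n) (ha0 : a 0 = 0) {x y : ℝ} (hx : 1 ≤ x)
    (hxy : x ≤ y) : rieszMean a y - rieszMean a x ≤ summatory a y * (1 / x - 1 / y) := by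
  have hx0 : 0 < x := by linarith
  rw [rieszMean_sub_eq_integral ha ha0 hx hxy, ← integral_const_div_sq _ hx0 hxy]
  refine intervalIntegral.integral_mono_on hxy (intervalIntegrable_summatory_div_sq ha hx0 hxy)
    (intervalIntegrable_const_div_sq _ hx0 hxy) fun t ht => ?_
  gcongr
  exact summatory_mono ha ht.2

theorem abs_rieszMean_exp_sub_le (ha : ∀ n, 0 ≤ a n) (ha0 : a 0 = 0) {C : ℝ} (hC0 : 0 ≤ C)
    (hC : ∀ n : ℕ, ∑ k ∈ Finset.Icc 1 n, a k ≤ C * n) {s t : ℝ} (hs : 0 ≤ s) (ht : 0 ≤ t) :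
    |rieszMean a (Real.exp t) - rieszMean a (Real.exp s)| ≤ C * |t - s| := by
  wlog hst : s ≤ t generalizing s t
  · rw [abs_sub_comm, abs_sub_comm t s]
    exact this ht hs (not_le.1 hst).le
  have h1 : (1 : ℝ) ≤ Real.exp s := Real.one_le_exp hs
  have h0 : (0 : ℝ) < Real.exp s := Real.exp_pos s
  have hst' : Real.exp s ≤ Real.exp t := Real.exp_le_exp.2 hst
  rw [rieszMean_sub_eq_integral ha ha0 h1 hst', abs_of_nonneg, abs_of_nonneg (sub_nonneg.2 hst)]
  · have h2 : ∫ u in Real.exp s..Real.exp t, C * (1 / u) = C * (t - s) := by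
      rw [intervalIntegral.integral_const_mul, integral_one_div_of_pos h0 (Real.exp_pos t),
        ← Real.exp_sub, Real.log_exp]
    rw [← h2]
    refine intervalIntegral.integral_mono_on hst' (intervalIntegrable_summatory_div_sq ha h0 hst')
      ?_ fun u hu => ?_
    · apply ContinuousOn.intervalIntegrable
      rw [Set.uIcc_of_le hst']
      refine continuousOn_const.mul (ContinuousOn.div (by fun_prop) (by fun_prop) fun u hu => ?_)
      exact (h0.trans_le hu.1).ne'
    · have hu0 : 0 < u := h0.trans_le hu.1
      have := summatory_le hC0 hC hu0.le
      calc summatory a u / u ^ 2 ≤ C * u / u ^ 2 := by gcongr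
        _ = C * (1 / u) := by field_simp
  · refine intervalIntegral.integral_nonneg hst' fun u _ => ?_
    have := summatory_nonneg ha u
    positivity

theorem rieszMean_one : rieszMean a 1 = 0 := by
  simp [rieszMean, summatory]

/-- The Laplace transform of a summatory function in logarithmic scale. -/
theorem integral_summatory_exp_mul_exp {f : ℕ → ℝ} (hf : ∀ n, 0 ≤ f n) {r : ℝ} (hr : 0 ≤ r) {s : ℂ}
    (hs : r < s.re)
    (hO : (fun n => ∑ k ∈ Finset.Icc 1 n, f k) =O[atTop] fun n => (n : ℝ) ^ r) :
    ∫ t : ℝ in Set.Ioi 0, (summatory f (Real.exp t) : ℂ) * Complex.exp (-s * t) =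
      LSeries (fun n => f n) s / s := by
  have hs0 : s ≠ 0 := by
    rintro rfl
    simp at hs
    linarith
  rw [LSeries_eq_mul_integral_of_nonneg f hr hs hO hf, mul_div_cancel_left₀ _ hs0,
    ← Real.exp_zero, ← integral_comp_exp_Ioi]
  refine integral_congr_ae (Eventually.of_forall fun t => ?_)
  have e : (Real.exp t : ℂ) ≠ 0 := by exact_mod_cast (Real.exp_pos t).ne'
  simp only [summatory, Complex.real_smul, Complex.ofReal_sum]
  rw [mul_left_comm]
  congr 1
  rw [Complex.cpow_def_of_ne_zero e, ← Complex.ofReal_log (Real.exp_pos t).le, Real.log_exp,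
    Complex.ofReal_exp, ← Complex.exp_add]
  congr 1
  ring

theorem integral_mul_exp_neg_mul {z : ℂ} (hz : 0 < z.re) :
    ∫ t : ℝ in Set.Ioi 0, (t : ℂ) * Complex.exp (-z * t) = 1 / z ^ 2 := by
  have hz0 : z ≠ 0 := by
    rintro rfl
    simp at hz
  have hd : ∀ t ∈ Set.Ici (0 : ℝ), HasDerivAt
      (fun t : ℝ => -((t : ℂ) / z + 1 / z ^ 2) * Complex.exp (-z * t))
      ((t : ℂ) * Complex.exp (-z * t)) t := by
    intro t _
    have h1 : HasDerivAt (fun t : ℝ => (t : ℂ)) 1 t := Complex.ofRealCLM.hasDerivAt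
    have h2 : HasDerivAt (fun t : ℝ => Complex.exp (-z * t)) (Complex.exp (-z * t) * (-z * 1)) t :=
      (h1.const_mul (-z)).cexp
    refine (((h1.div_const z).add_const (1 / z ^ 2)).neg.mul h2).congr_deriv ?_
    simp only [Pi.neg_apply]
    field_simp
    ring
  have hi := (integrableOn_mul_exp_of_linear_growth (F := fun t : ℝ => (t : ℂ)) (C := 1) (z := z)
    (by fun_prop) (fun t _ => by simp [Real.norm_eq_abs]) hz).mono_set Set.Ioi_subset_Ici_self
  have ht : Tendsto (fun t : ℝ => -((t : ℂ) / z + 1 / z ^ 2) * Complex.exp (-z * t)) atTop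
      (𝓝 0) := by
    have key : ∀ n : ℕ, Tendsto (fun t : ℝ => (t : ℂ) ^ n * Complex.exp (-z * t)) atTop (𝓝 0) := by
      intro n
      rw [tendsto_zero_iff_norm_tendsto_zero]
      have := tendsto_rpow_mul_exp_neg_mul_atTop_nhds_zero n z.re hz
      refine this.congr' ?_
      filter_upwards [eventually_ge_atTop 0] with t ht
      rw [norm_mul, norm_pow, Complex.norm_exp, Complex.norm_real, Real.norm_of_nonneg ht,
        Real.rpow_natCast]
      simp
    have h := ((key 1).const_mul (-1 / z)).add ((key 0).const_mul (-1 / z ^ 2))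
    simp only [mul_zero, add_zero] at h
    refine h.congr fun t => ?_
    ring
  rw [integral_Ioi_of_hasDerivAt_of_tendsto' hd hi ht]
  simp

theorem integral_exp_neg_mul {z : ℂ} (hz : 0 < z.re) :
    ∫ t : ℝ in Set.Ioi 0, Complex.exp (-z * t) = 1 / z := by
  rw [integral_exp_mul_complex_Ioi (by simpa using hz)]
  simp


theorem summatory_div_isBigO {C : ℝ} (hC0 : 0 ≤ C) (ha : ∀ n, 0 ≤ a n) (ha0 : a 0 = 0)
    (hC : ∀ n : ℕ, ∑ k ∈ Finset.Icc 1 n, a k ≤ C * n) {r : ℝ} (hr : 0 < r) :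
    (fun n : ℕ => ∑ k ∈ Finset.Icc 1 n, a k / k) =O[atTop] fun n => (n : ℝ) ^ r := by
  have h1 : (fun n : ℕ => ∑ k ∈ Finset.Icc 1 n, a k / k) =O[atTop]
      fun n : ℕ => 1 + Real.log n := by
    refine Asymptotics.IsBigO.of_bound C ?_
    filter_upwards [eventually_ge_atTop 1] with n hn
    have hn1 : (1 : ℝ) ≤ n := by exact_mod_cast hn
    have hlog := Real.log_nonneg hn1
    have e : ∑ k ∈ Finset.Icc 1 n, a k / k = rieszMean a n + summatory a n / n := by
      simp [rieszMean, summatory]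
    rw [Real.norm_of_nonneg (Finset.sum_nonneg fun k _ => div_nonneg (ha k) k.cast_nonneg),
      Real.norm_of_nonneg (by positivity), e]
    have h2 := abs_rieszMean_exp_sub_le ha ha0 hC0 hC le_rfl hlog
    rw [Real.exp_log (by linarith), Real.exp_zero, rieszMean_one, sub_zero, sub_zero,
      abs_of_nonneg hlog] at h2
    have h3 : summatory a n / n ≤ C := by
      rw [div_le_iff₀ (by linarith)]
      exact summatory_le hC0 hC (by linarith)
    have := le_abs_self (rieszMean a n)
    linarith
  refine h1.trans (Asymptotics.IsBigO.add ?_ ?_)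
  · refine Asymptotics.IsBigO.of_bound 1 ?_
    filter_upwards [eventually_ge_atTop 1] with n hn
    have hn1 : (1 : ℝ) ≤ n := by exact_mod_cast hn
    rw [Real.norm_of_nonneg (by positivity), Real.norm_of_nonneg (by positivity), one_mul]
    exact Real.one_le_rpow hn1 hr.le
  · exact (isLittleO_log_rpow_atTop hr).isBigO.comp_tendsto tendsto_natCast_atTop_atTop

/-- The Laplace transform of the Riesz mean in logarithmic scale. -/
theorem integral_rieszMean_exp_mul_exp {C : ℝ} (hC0 : 0 ≤ C) (ha : ∀ n, 0 ≤ a n) (ha0 : a 0 = 0)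
    (hC : ∀ n : ℕ, ∑ k ∈ Finset.Icc 1 n, a k ≤ C * n) {z : ℂ} (hz : 0 < z.re) :
    ∫ t : ℝ in Set.Ioi 0, (rieszMean a (Real.exp t) : ℂ) * Complex.exp (-z * t) =
      LSeries (fun n => a n) (1 + z) / (z * (1 + z)) := by
  have hz0 : z ≠ 0 := by
    rintro rfl
    simp at hz
  have hz1 : 1 + z ≠ 0 := by
    intro h
    have := congrArg Complex.re h
    simp at this
    linarith
  have i1 := integral_summatory_exp_mul_exp (f := fun n => a n / n) (r := z.re / 2) (s := z)
    (fun n => div_nonneg (ha n) n.cast_nonneg) (by linarith) (by linarith)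
    (summatory_div_isBigO hC0 ha ha0 hC (by linarith))
  have hO : (fun n : ℕ => ∑ k ∈ Finset.Icc 1 n, a k) =O[atTop] fun n => (n : ℝ) ^ (1 : ℝ) := by
    refine Asymptotics.IsBigO.of_bound C (Eventually.of_forall fun n => ?_)
    rw [Real.norm_of_nonneg (Finset.sum_nonneg fun k _ => ha k), Real.rpow_one,
      Real.norm_of_nonneg (by positivity)]
    exact hC n
  have i2 := integral_summatory_exp_mul_exp (f := a) (r := 1) (s := 1 + z) ha zero_le_one
    (by simpa using hz) hO
  have eL : LSeries (fun n => ((a n / n : ℝ) : ℂ)) z = LSeries (fun n => a n) (1 + z) := by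
    refine tsum_congr fun n => ?_
    rcases eq_or_ne n 0 with rfl | hn
    · simp
    · have hn' : (n : ℂ) ≠ 0 := by exact_mod_cast hn
      rw [LSeries.term_of_ne_zero hn, LSeries.term_of_ne_zero hn, Complex.cpow_add _ _ hn',
        Complex.cpow_one]
      push_cast
      rw [div_div]
  have hA : ∀ t : ℝ, (summatory a (Real.exp t) : ℂ) * Complex.exp (-(1 + z) * t) =
      ((summatory a (Real.exp t) / Real.exp t : ℝ) : ℂ) * Complex.exp (-z * t) := by
    intro t
    rw [neg_add, add_mul, Complex.exp_add, neg_one_mul, Complex.exp_neg]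
    push_cast
    rw [div_eq_mul_inv]
    ring
  have mA : Measurable (summatory a) := (summatory_mono ha).measurable
  have mS : Measurable (summatory fun n => a n / n) :=
    (summatory_mono fun n => div_nonneg (ha n) n.cast_nonneg).measurable
  have int1 : IntegrableOn (fun t : ℝ => (rieszMean a (Real.exp t) : ℂ) * Complex.exp (-z * t))
      (Set.Ioi 0) := by
    refine (integrableOn_mul_exp_of_linear_growth (C := C) ?_ (fun t ht => ?_) hz).mono_set
      Set.Ioi_subset_Ici_self
    · refine Measurable.aestronglyMeasurable ?_
      unfold rieszMean
      fun_prop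
    · have := abs_rieszMean_exp_sub_le ha ha0 hC0 hC le_rfl ht
      rw [Real.exp_zero, rieszMean_one, sub_zero, sub_zero] at this
      rw [Complex.norm_real, Real.norm_eq_abs]
      nlinarith [abs_nonneg t]
  have int2 : IntegrableOn (fun t : ℝ => ((summatory a (Real.exp t) / Real.exp t : ℝ) : ℂ) *
      Complex.exp (-z * t)) (Set.Ioi 0) := by
    refine (integrableOn_mul_exp_of_linear_growth (C := C) ?_ (fun t ht => ?_) hz).mono_set
      Set.Ioi_subset_Ici_self
    · refine Measurable.aestronglyMeasurable ?_
      fun_prop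
    · have h1 : summatory a (Real.exp t) / Real.exp t ≤ C := by
        rw [div_le_iff₀ (Real.exp_pos t)]
        exact summatory_le hC0 hC (Real.exp_pos t).le
      rw [Complex.norm_real, Real.norm_of_nonneg
        (div_nonneg (summatory_nonneg ha _) (Real.exp_pos t).le)]
      nlinarith [abs_nonneg t]
  have hsum : ∫ t : ℝ in Set.Ioi 0, (summatory (fun n => a n / n) (Real.exp t) : ℂ) *
      Complex.exp (-z * t) = (∫ t : ℝ in Set.Ioi 0, (rieszMean a (Real.exp t) : ℂ) *
      Complex.exp (-z * t)) + ∫ t : ℝ in Set.Ioi 0,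
        ((summatory a (Real.exp t) / Real.exp t : ℝ) : ℂ) * Complex.exp (-z * t) := by
    rw [← integral_add int1 int2]
    refine integral_congr_ae (Eventually.of_forall fun t => ?_)
    simp only [rieszMean]
    push_cast
    ring
  simp_rw [hA] at i2
  rw [i1, i2, eL] at hsum
  rw [← sub_eq_iff_eq_add] at hsum
  rw [← hsum]
  field_simp
  ring

/-- The Tauberian theorem gives the asymptotics of the Riesz mean. -/
theorem tendsto_rieszMean_exp_sub {C δ : ℝ} {G : ℂ → ℂ} (hC0 : 0 ≤ C) (ha : ∀ n, 0 ≤ a n)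
    (ha0 : a 0 = 0) (hC : ∀ n : ℕ, ∑ k ∈ Finset.Icc 1 n, a k ≤ C * n)
    (hG : ContinuousOn G {s | 1 ≤ s.re}) (hG1 : DifferentiableAt ℂ G 1)
    (hL : ∀ s : ℂ, 1 < s.re → LSeries (fun n => a n) s = δ / (s - 1) + G s) :
    Tendsto (fun t : ℝ => ((rieszMean a (Real.exp t) - δ * t : ℝ) : ℂ)) atTop (𝓝 (G 1 - δ)) := by
  set c : ℂ := G 1 - δ with hc
  set N : ℂ → ℂ := fun z => (G (1 + z) - δ) / (1 + z) with hN
  have hN0 : N 0 = c := by simp [hN, hc]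
  set H : ℝ → ℂ := fun t => if 0 ≤ t then
    ((rieszMean a (Real.exp t) - δ * t : ℝ) : ℂ) - c else 0 with hH
  have hpos : ∀ z : ℂ, 0 ≤ z.re → 1 + z ≠ 0 := by
    intro z hz h
    have := congrArg Complex.re h
    simp at this
    linarith
  have mA : Measurable (summatory a) := (summatory_mono ha).measurable
  have mS : Measurable (summatory fun n => a n / n) :=
    (summatory_mono fun n => div_nonneg (ha n) n.cast_nonneg).measurable
  have mR : Measurable (rieszMean a) := by
    unfold rieszMean
    fun_prop
  have key : Tendsto H atTop (𝓝 0) := by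
    refine tendsto_zero_of_laplace (h := dslope N 0) (C := C + |δ| + ‖c‖) ?_ ?_ ?_ ?_ ?_
    · refine Measurable.aestronglyMeasurable ?_
      exact Measurable.ite measurableSet_Ici (by fun_prop) measurable_const
    · filter_upwards [eventually_ge_atTop 1] with T hT t
      have hT0 : 0 ≤ T := by linarith
      simp only [hH, if_pos hT0]
      have hlin : ∀ t, 0 ≤ t → |(rieszMean a (Real.exp t) - δ * t) -
          (rieszMean a (Real.exp T) - δ * T)| ≤ (C + |δ|) * |t - T| := by
        intro t ht
        have h1 := abs_rieszMean_exp_sub_le ha ha0 hC0 hC hT0 ht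
        have h2 : |δ * (t - T)| = |δ| * |t - T| := abs_mul _ _
        have h3 := abs_sub (rieszMean a (Real.exp t) - rieszMean a (Real.exp T)) (δ * (t - T))
        have e : (rieszMean a (Real.exp t) - δ * t) - (rieszMean a (Real.exp T) - δ * T) =
          rieszMean a (Real.exp t) - rieszMean a (Real.exp T) - δ * (t - T) := by ring
        rw [e]
        linarith
      by_cases ht : 0 ≤ t
      · rw [if_pos ht, sub_sub_sub_cancel_right, ← Complex.ofReal_sub, Complex.norm_real,
          Real.norm_eq_abs]
        refine (hlin t ht).trans ?_
        refine mul_le_mul_of_nonneg_right ?_ (abs_nonneg _)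
        linarith [norm_nonneg c]
      · -- at negative `t` the jump `‖c‖` is absorbed using `T ≥ 1`
        rw [if_neg ht, zero_sub, norm_neg]
        push Not at ht
        refine (norm_sub_le _ _).trans ?_
        have h0 := hlin 0 le_rfl
        rw [Real.exp_zero, rieszMean_one, mul_zero, sub_zero, zero_sub, zero_sub, abs_neg,
          abs_neg, abs_of_nonneg hT0] at h0
        rw [Complex.norm_real, Real.norm_eq_abs, abs_of_neg (by linarith : t - T < 0)]
        have h4 : (C + |δ|) * T ≤ (C + |δ|) * (-(t - T)) := by
          gcongr
          linarith
        nlinarith [norm_nonneg c]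
    · intro t ht
      simp only [hH, if_neg (not_le.2 ht)]
    · intro z hz
      rcases eq_or_ne z 0 with rfl | hz0
      · refine ContinuousAt.continuousWithinAt (continuousAt_dslope_same.2 ?_)
        have : DifferentiableAt ℂ (fun z : ℂ => G (1 + z)) 0 := by
          rw [show (1 : ℂ) = 1 + 0 by simp] at hG1
          exact hG1.comp 0 (by fun_prop)
        exact (this.sub_const _).div (by fun_prop) (by simp)
      · rw [continuousWithinAt_dslope_of_ne hz0]
        have h1 : ContinuousOn (fun z : ℂ => G (1 + z)) {z | 0 ≤ z.re} := by
          refine hG.comp (by fun_prop) fun z hz => ?_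
          have : 0 ≤ z.re := hz
          simpa using this
        exact (h1.sub continuousOn_const).div (by fun_prop) (fun z hz => hpos z hz) z hz
    · intro z hz
      have hz0 : z ≠ 0 := by
        rintro rfl
        simp at hz
      have hz1 := hpos z hz.le
      have e1 : ∫ t : ℝ, H t * Complex.exp (-z * t) = ∫ t : ℝ in Set.Ioi 0,
          ((rieszMean a (Real.exp t) : ℂ) * Complex.exp (-z * t) -
            δ * ((t : ℂ) * Complex.exp (-z * t)) - c * Complex.exp (-z * t)) := by
        rw [← integral_Ici_eq_integral_Ioi, ← integral_indicator measurableSet_Ici]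
        refine integral_congr_ae (Eventually.of_forall fun t => ?_)
        by_cases ht : 0 ≤ t
        · rw [Set.indicator_of_mem (Set.mem_Ici.2 ht)]
          simp only [hH, if_pos ht]
          push_cast
          ring
        · rw [Set.indicator_of_notMem (by simpa using ht)]
          simp only [hH, if_neg ht, zero_mul]
      have j1 : IntegrableOn (fun t : ℝ => (rieszMean a (Real.exp t) : ℂ) * Complex.exp (-z * t))
          (Set.Ioi 0) := by
        refine (integrableOn_mul_exp_of_linear_growth (C := C)
          (Measurable.aestronglyMeasurable (by fun_prop)) (fun t ht => ?_) hz).mono_set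
          Set.Ioi_subset_Ici_self
        have := abs_rieszMean_exp_sub_le ha ha0 hC0 hC le_rfl ht
        rw [Real.exp_zero, rieszMean_one, sub_zero, sub_zero] at this
        rw [Complex.norm_real, Real.norm_eq_abs]
        nlinarith [abs_nonneg t]
      have j2 : IntegrableOn (fun t : ℝ => (t : ℂ) * Complex.exp (-z * t)) (Set.Ioi 0) :=
        (integrableOn_mul_exp_of_linear_growth (F := fun t : ℝ => (t : ℂ)) (C := 1) (z := z)
          (by fun_prop) (fun t _ => by simp [Real.norm_eq_abs]) hz).mono_set
          Set.Ioi_subset_Ici_self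
      have j3 : IntegrableOn (fun t : ℝ => Complex.exp (-z * t)) (Set.Ioi 0) := by
        have := (integrableOn_mul_exp_of_linear_growth (F := fun _ : ℝ => (1 : ℂ)) (C := 1) (z := z)
          (by fun_prop) (fun t _ => by simp) hz).mono_set
          Set.Ioi_subset_Ici_self
        simpa using this
      have e2 : IntegrableOn (fun t : ℝ => (rieszMean a (Real.exp t) : ℂ) * Complex.exp (-z * t) -
            δ * ((t : ℂ) * Complex.exp (-z * t))) (Set.Ioi 0) := j1.sub (j2.const_mul _)
      rw [e1, integral_sub e2 (j3.const_mul _),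
        integral_sub j1 (j2.const_mul _), integral_const_mul, integral_const_mul,
        integral_rieszMean_exp_mul_exp hC0 ha ha0 hC hz, integral_mul_exp_neg_mul hz,
        integral_exp_neg_mul hz, dslope_of_ne _ hz0, slope_def_field, hN0,
        hL (1 + z) (by simpa using hz), hN]
      simp only [add_sub_cancel_left, sub_zero]
      field_simp
      ring
  have h2 := key.add_const c
  rw [zero_add] at h2
  refine h2.congr' ?_
  filter_upwards [eventually_ge_atTop 0] with t ht
  simp only [hH, if_pos ht, sub_add_cancel]

/-- The mean value of `a` is recovered from the Riesz mean, because `a` is nonnegative: over an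
interval of logarithmic length `η` the Riesz mean varies by about `η` times the average. -/
theorem tendsto_summatory_exp_div {δ ρ : ℝ} (ha : ∀ n, 0 ≤ a n)
    (ha0 : a 0 = 0) (hR : Tendsto (fun t : ℝ => rieszMean a (Real.exp t) - δ * t) atTop (𝓝 ρ)) :
    Tendsto (fun t : ℝ => summatory a (Real.exp t) / Real.exp t) atTop (𝓝 δ) := by
  have hinc : ∀ η : ℝ, Tendsto (fun t : ℝ => rieszMean a (Real.exp (t + η)) -
      rieszMean a (Real.exp t)) atTop (𝓝 (δ * η)) := by
    intro η
    have h1 := hR.comp (tendsto_atTop_add_const_right atTop η tendsto_id)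
    have h2 := (h1.sub hR).add_const (δ * η)
    rw [sub_self, zero_add] at h2
    refine h2.congr fun t => ?_
    simp only [Function.comp_apply, id]
    ring
  have hexp : Tendsto (fun η : ℝ => (Real.exp η - 1) / η) (𝓝[≠] 0) (𝓝 1) := by
    have := hasDerivAt_iff_tendsto_slope.1 (Real.hasDerivAt_exp 0)
    rw [Real.exp_zero] at this
    refine this.congr fun η => ?_
    rw [slope_def_field, sub_zero, Real.exp_zero]
  rw [tendsto_order]
  constructor
  · intro b hb
    have l1 : Tendsto (fun η : ℝ => δ * ((Real.exp η - 1) / η)⁻¹) (𝓝[>] 0) (𝓝 δ) := by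
      simpa using ((hexp.mono_left (nhdsGT_le_nhdsNE 0)).inv₀
        one_ne_zero).const_mul δ
    obtain ⟨η, hη1, hη0⟩ := ((l1.eventually_const_lt hb).and self_mem_nhdsWithin).exists
    replace hη0 : 0 < η := hη0
    have hpos : 0 < Real.exp η - 1 := by
      have := Real.add_one_lt_exp hη0.ne'; linarith
    have h3 : b * (Real.exp η - 1) < δ * η := by
      rw [inv_div, mul_div_assoc', lt_div_iff₀ hpos] at hη1
      exact hη1
    have h4 := ((hinc η).comp (tendsto_atTop_add_const_right atTop (-η) tendsto_id)).eventually
      (lt_mem_nhds h3)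
    filter_upwards [h4, eventually_ge_atTop η] with t ht htη
    simp only [Function.comp_apply, id, neg_add_cancel_right] at ht
    have h5 := rieszMean_sub_le ha ha0 (x := Real.exp (t + -η)) (y := Real.exp t)
      (Real.one_le_exp (by linarith)) (Real.exp_le_exp.2 (by linarith))
    have e : summatory a (Real.exp t) * (1 / Real.exp (t + -η) - 1 / Real.exp t) =
        summatory a (Real.exp t) / Real.exp t * (Real.exp η - 1) := by
      rw [Real.exp_add, Real.exp_neg]
      have := (Real.exp_pos t).ne'
      have := (Real.exp_pos η).ne'
      field_simp
    rw [e] at h5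
    exact lt_of_mul_lt_mul_right (ht.trans_le h5) hpos.le
  · intro b hb
    have l1 : Tendsto (fun η : ℝ => δ * ((Real.exp (-η) - 1) / (-η))⁻¹) (𝓝[>] 0) (𝓝 δ) := by
      have hneg : Tendsto (fun η : ℝ => -η) (𝓝[>] 0) (𝓝[≠] 0) := by
        refine tendsto_nhdsWithin_iff.2 ⟨?_, ?_⟩
        · have : Tendsto (fun η : ℝ => -η) (𝓝 0) (𝓝 (-0)) := continuous_neg.tendsto 0
          rw [neg_zero] at this
          exact this.mono_left nhdsWithin_le_nhds
        · filter_upwards [self_mem_nhdsWithin] with η (hη : 0 < η)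
          simpa using hη.ne'
      simpa using ((hexp.comp hneg).inv₀ one_ne_zero).const_mul δ
    obtain ⟨η, hη1, hη0⟩ := ((l1.eventually_lt_const hb).and self_mem_nhdsWithin).exists
    replace hη0 : 0 < η := hη0
    have hpos : 0 < 1 - Real.exp (-η) := by
      have := Real.exp_lt_one_iff.2 (by linarith : -η < 0); linarith
    have h3 : δ * η < b * (1 - Real.exp (-η)) := by
      rw [inv_div, mul_div_assoc', ← neg_div_neg_eq, div_lt_iff₀ (by linarith)] at hη1
      linarith
    filter_upwards [(hinc η).eventually (gt_mem_nhds h3), eventually_ge_atTop 0] with t ht ht0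
    have h5 := le_rieszMean_sub ha ha0 (x := Real.exp t) (y := Real.exp (t + η))
      (Real.one_le_exp ht0) (Real.exp_le_exp.2 (by linarith))
    have e : summatory a (Real.exp t) * (1 / Real.exp t - 1 / Real.exp (t + η)) =
        summatory a (Real.exp t) / Real.exp t * (1 - Real.exp (-η)) := by
      rw [Real.exp_add, Real.exp_neg]
      have := (Real.exp_pos t).ne'
      have := (Real.exp_pos η).ne'
      field_simp
    rw [e] at h5
    exact lt_of_mul_lt_mul_right (h5.trans_lt ht) hpos.le

/-- **Tauberian theorem for Dirichlet series.** If `a` is nonnegative with `∑_{n ≤ x} a(n) = O(x)`,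
and `∑ a(n) n⁻ˢ - δ / (s - 1)` extends to a function `G` which is continuous on `1 ≤ Re s` and
differentiable at `1`, then `∑_{n ≤ x} a(n) / n = δ log x + G(1) + o(1)`. -/
theorem tendsto_summatory_div_sub_log {C δ : ℝ} {G : ℂ → ℂ} (hC0 : 0 ≤ C) (ha : ∀ n, 0 ≤ a n)
    (ha0 : a 0 = 0) (hC : ∀ n : ℕ, ∑ k ∈ Finset.Icc 1 n, a k ≤ C * n)
    (hG : ContinuousOn G {s | 1 ≤ s.re}) (hG1 : DifferentiableAt ℂ G 1)
    (hL : ∀ s : ℂ, 1 < s.re → LSeries (fun n => a n) s = δ / (s - 1) + G s) :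
    Tendsto (fun x : ℝ => ((summatory (fun n => a n / n) x - δ * Real.log x : ℝ) : ℂ)) atTop
      (𝓝 (G 1)) := by
  have h1 := tendsto_rieszMean_exp_sub hC0 ha ha0 hC hG hG1 hL
  have h2 : Tendsto (fun t : ℝ => rieszMean a (Real.exp t) - δ * t) atTop (𝓝 (G 1 - δ).re) := by
    have := (Complex.continuous_re.tendsto _).comp h1
    refine this.congr fun t => ?_
    simp only [Function.comp_apply, Complex.ofReal_re]
  have h3 := tendsto_summatory_exp_div ha ha0 h2
  have h4 : Tendsto (fun t : ℝ => ((summatory a (Real.exp t) / Real.exp t : ℝ) : ℂ)) atTop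
      (𝓝 δ) := (Complex.continuous_ofReal.tendsto _).comp h3
  have h5 := (h1.add h4).comp Real.tendsto_log_atTop
  rw [sub_add_cancel] at h5
  refine h5.congr' ?_
  filter_upwards [eventually_gt_atTop 0] with x hx
  simp only [Function.comp_apply, Real.exp_log hx, rieszMean]
  push_cast
  ring

end summatory

end

/-! ### The von Mangoldt function in residue classes -/

section

open ArithmeticFunction.vonMangoldt DirichletCharacter

theorem differentiableAt_LFunctionResidueClassAux_one {q : ℕ} [NeZero q] (a : ZMod q) :
    DifferentiableAt ℂ (LFunctionResidueClassAux a) 1 := by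
  unfold LFunctionResidueClassAux
  have hT := differentiable_LFunctionTrivChar₁ q
  refine DifferentiableAt.const_mul (DifferentiableAt.sub ?_ ?_) _
  · exact ((hT.analyticAt 1).deriv.differentiableAt.neg).div (hT 1)
      (LFunctionTrivChar₁_apply_one_ne_zero q)
  · refine DifferentiableAt.fun_sum fun χ hχ => ?_
    have hχ : χ ≠ 1 := by simpa using hχ
    have hL := differentiable_LFunction hχ
    exact ((hL.analyticAt 1).deriv.differentiableAt.const_mul _).div (hL 1)
      (LFunction_apply_one_ne_zero hχ)

theorem sum_residueClass_le {q : ℕ} (a : ZMod q) (n : ℕ) :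
    ∑ k ∈ Finset.Icc 1 n, residueClass a k ≤ (Real.log 4 + 4) * n := by
  have h := Chebyshev.psi_le_const_mul_self (x := n) n.cast_nonneg
  rw [Chebyshev.psi, Nat.floor_natCast] at h
  exact (Finset.sum_le_sum fun k _ => residueClass_le a k).trans h

/-- The prime number theorem in arithmetic progressions, in the form of an asymptotic formula for
`∑ Λ(n) / n` over a residue class. -/
theorem tendsto_sum_residueClass_div {q : ℕ} [NeZero q] {a : ZMod q} (ha : IsUnit a) :
    Tendsto (fun x : ℝ => ((summatory (fun n => residueClass a n / n) x -
      (q.totient : ℝ)⁻¹ * Real.log x : ℝ) : ℂ)) atTop (𝓝 (LFunctionResidueClassAux a 1)) := by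
  refine tendsto_summatory_div_sub_log (C := Real.log 4 + 4) (by positivity)
    (residueClass_nonneg a) (residueClass_apply_zero a) (sum_residueClass_le a)
    (continuousOn_LFunctionResidueClassAux a) (differentiableAt_LFunctionResidueClassAux_one a)
    fun s hs => ?_
  have := eqOn_LFunctionResidueClassAux ha hs
  rw [this]
  push_cast
  ring

theorem hasDerivAt_LFunctionTrivChar₁_one :
    HasDerivAt (LFunctionTrivChar₁ 1) Real.eulerMascheroniConstant 1 := by
  rw [hasDerivAt_iff_tendsto_slope]
  refine tendsto_riemannZeta_sub_one_div.congr' ?_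
  filter_upwards [self_mem_nhdsWithin] with s (hs : s ≠ 1)
  have hs' := sub_ne_zero.2 hs
  rw [slope_def_field, LFunctionTrivChar₁, Function.update_self, Function.update_of_ne hs,
    LFunctionTrivChar_eq_mul_riemannZeta hs]
  simp only [Nat.primeFactors_one, Finset.prod_empty, one_mul]
  field_simp

theorem LFunctionTrivChar₁_one_apply_one : LFunctionTrivChar₁ 1 1 = 1 := by
  simp [LFunctionTrivChar₁]

/-- For a prime `q`, the trivial character modulo `q` contributes the Euler factor of `ζ` at `q`. -/
theorem LFunctionTrivChar₁_prime (q : ℕ) [hq : Fact q.Prime] (s : ℂ) :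
    LFunctionTrivChar₁ q s = LFunctionTrivChar₁ 1 s * (1 - (q : ℂ) ^ (-s)) := by
  rcases eq_or_ne s 1 with rfl | hs
  · simp [LFunctionTrivChar₁, hq.out.primeFactors, Complex.cpow_neg_one]
  · rw [LFunctionTrivChar₁, LFunctionTrivChar₁, Function.update_of_ne hs, Function.update_of_ne hs,
      LFunctionTrivChar_eq_mul_riemannZeta hs, LFunctionTrivChar_eq_mul_riemannZeta hs]
    simp only [Nat.primeFactors_one, Finset.prod_empty, one_mul, hq.out.primeFactors,
      Finset.prod_singleton]
    ring

theorem deriv_div_LFunctionTrivChar₁_prime (q : ℕ) [hq : Fact q.Prime] :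
    deriv (LFunctionTrivChar₁ q) 1 / LFunctionTrivChar₁ q 1 =
      Real.eulerMascheroniConstant + Real.log q / ((q : ℂ) - 1) := by
  have hq0 : (q : ℂ) ≠ 0 := by exact_mod_cast hq.out.ne_zero
  have hq1 : (q : ℂ) - 1 ≠ 0 := by
    rw [sub_ne_zero]
    exact_mod_cast hq.out.one_lt.ne'
  have h1 : HasDerivAt (fun s : ℂ => (q : ℂ) ^ (-s)) ((q : ℂ) ^ (-(1 : ℂ)) * Complex.log q * -1) 1 :=
    (hasDerivAt_neg (1 : ℂ)).const_cpow (Or.inl hq0)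
  have h2 := hasDerivAt_LFunctionTrivChar₁_one.mul (h1.const_sub 1)
  have h3 : LFunctionTrivChar₁ q = LFunctionTrivChar₁ 1 * fun s : ℂ => 1 - (q : ℂ) ^ (-s) :=
    funext fun s => LFunctionTrivChar₁_prime q s
  rw [h3, h2.deriv]
  simp only [Pi.mul_apply, LFunctionTrivChar₁_one_apply_one, Complex.cpow_neg_one,
    ← Complex.natCast_log]
  field_simp

open scoped Classical in
/-- The sum of `L'/L(1, χ)` over the nontrivial characters `χ` modulo `q`. -/
noncomputable def sumLogDerivOne (q : ℕ) [NeZero q] : ℂ :=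
  ∑ χ ∈ ({1}ᶜ : Finset (DirichletCharacter ℂ q)), deriv (LFunction χ) 1 / LFunction χ 1

/-- The constants of the residue classes other than `0` and `1` add up, by orthogonality of
characters. -/
theorem sum_LFunctionResidueClassAux_one (q : ℕ) [hq : Fact q.Prime] :
    ∑ a ∈ ({0, 1}ᶜ : Finset (ZMod q)), LFunctionResidueClassAux a 1 =
      ((q : ℂ) - 1)⁻¹ * (-((q : ℂ) - 2) *
        (Real.eulerMascheroniConstant + Real.log q / ((q : ℂ) - 1)) + sumLogDerivOne q) := by
  have hcard : ((({0, 1}ᶜ : Finset (ZMod q)).card : ℕ) : ℂ) = (q : ℂ) - 2 := by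
    rw [Finset.card_compl, ZMod.card, Finset.card_pair zero_ne_one, Nat.cast_sub hq.out.two_le]
    simp
  have hsum : ∀ χ : DirichletCharacter ℂ q, χ ≠ 1 →
      ∑ a ∈ ({0, 1}ᶜ : Finset (ZMod q)), χ a⁻¹ = -1 := by
    intro χ hχ
    have h0 := MulChar.sum_eq_zero_of_ne_one hχ
    have h1 : ∑ a : ZMod q, χ a⁻¹ = ∑ a : ZMod q, χ a :=
      Equiv.sum_comp (Equiv.inv (ZMod q)) (fun a => χ a)
    rw [h0, ← Finset.sum_add_sum_compl {0, 1}, Finset.sum_pair zero_ne_one, inv_zero, inv_one,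
      χ.map_zero, map_one, zero_add] at h1
    linear_combination h1
  have htot : ((q.totient : ℕ) : ℂ) = (q : ℂ) - 1 := by
    rw [Nat.totient_prime hq.out, Nat.cast_sub hq.out.one_le, Nat.cast_one]
  unfold LFunctionResidueClassAux
  rw [← Finset.mul_sum, Finset.sum_sub_distrib, Finset.sum_const, nsmul_eq_mul, hcard, htot,
    neg_div, deriv_div_LFunctionTrivChar₁_prime, Finset.sum_comm]
  congr 1
  have hS : ∀ S : Finset (DirichletCharacter ℂ q), (∀ χ, χ ∈ S ↔ χ ≠ 1) →
      ∑ χ ∈ S, deriv (LFunction χ) 1 / LFunction χ 1 = sumLogDerivOne q := fun S hS =>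
    Finset.sum_congr (by ext; simp [hS]) fun _ _ => rfl
  have h2 : ∀ χ : DirichletCharacter ℂ q, χ ≠ 1 →
      ∑ a ∈ ({0, 1}ᶜ : Finset (ZMod q)), χ a⁻¹ * deriv (LFunction χ) 1 / LFunction χ 1 =
        - (deriv (LFunction χ) 1 / LFunction χ 1) := by
    intro χ hχ
    simp_rw [mul_div_assoc]
    rw [← Finset.sum_mul, hsum χ hχ, neg_one_mul]
  rw [Finset.sum_congr rfl fun χ hχ => h2 χ (by simpa using hχ), Finset.sum_neg_distrib,
    hS _ (by simp)]
  ring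

theorem primitiveRootChar_pow_apply (q : ℕ) [Fact q.Prime] (g : (ZMod q)ˣ)
    (hg : ∀ x, x ∈ Subgroup.zpowers g) (k : ℕ) :
    (primitiveRootChar q g hg ^ k) g =
      Complex.exp (2 * Real.pi * Complex.I / ((q : ℂ) - 1)) ^ k := by
  rw [MulChar.pow_apply_coe, primitiveRootChar, MulChar.ofRootOfUnity_spec, Units.val_mk0]

/-- The nontrivial characters modulo `q` are the powers `χ_g ^ k` with `1 ≤ k ≤ q - 2`. -/
theorem sumLogDerivOne_eq_sum_pow (q : ℕ) [hq : Fact q.Prime] (g : (ZMod q)ˣ)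
    (hg : ∀ x, x ∈ Subgroup.zpowers g) :
    sumLogDerivOne q = ∑ k ∈ Finset.Icc 1 (q - 2),
      deriv (LFunction (primitiveRootChar q g hg ^ k)) 1 /
        LFunction (primitiveRootChar q g hg ^ k) 1 := by
  have hq2 := hq.out.two_le
  have hω : IsPrimitiveRoot (Complex.exp (2 * Real.pi * Complex.I / ((q : ℂ) - 1))) (q - 1) := by
    have := Complex.isPrimitiveRoot_exp (q - 1) (by omega)
    rwa [Nat.cast_sub (by omega), Nat.cast_one] at this
  have hone : ∀ k, primitiveRootChar q g hg ^ k = 1 ↔ q - 1 ∣ k := by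
    intro k
    rw [MulChar.eq_iff hg, primitiveRootChar_pow_apply, MulChar.one_apply_coe,
      hω.pow_eq_one_iff_dvd]
  rw [sumLogDerivOne]
  symm
  refine Finset.sum_bij (fun k _ => primitiveRootChar q g hg ^ k) ?_ ?_ ?_ (fun _ _ => rfl)
  · intro k hk
    rw [Finset.mem_Icc] at hk
    rw [Finset.mem_compl, Finset.mem_singleton, hone]
    intro h
    have := Nat.le_of_dvd (by omega) h
    omega
  · intro k hk l hl h
    rw [Finset.mem_Icc] at hk hl
    rw [MulChar.eq_iff hg, primitiveRootChar_pow_apply, primitiveRootChar_pow_apply] at h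
    exact hω.pow_inj (by omega) (by omega) h
  · intro χ hχ
    rw [Finset.mem_compl, Finset.mem_singleton] at hχ
    have hpow : χ (g : ZMod q) ^ (q - 1) = 1 := by
      rw [← map_pow, ZMod.pow_card_sub_one_eq_one g.ne_zero, map_one]
    have : NeZero (q - 1) := ⟨by omega⟩
    obtain ⟨k, hk, hk'⟩ := hω.eq_pow_of_pow_eq_one hpow
    have hχk : primitiveRootChar q g hg ^ k = χ := by
      rw [MulChar.eq_iff hg, primitiveRootChar_pow_apply, hk']
    refine ⟨k, ?_, hχk⟩
    rw [Finset.mem_Icc]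
    have : k ≠ 0 := by
      rintro rfl
      exact hχ (by rw [← hχk, pow_zero])
    omega

end

/-! ### The Euler product of the totient indicator -/

section

open ArithmeticFunction

/-- All prime factors `p` of `n` satisfy `p ≠ q` and `p ≢ 1 (mod q)`. -/
def HasNonSplitFactors (q n : ℕ) : Prop :=
  n ≠ 0 ∧ ∀ p : ℕ, p.Prime → p ∣ n → p ≠ q ∧ ¬ p ≡ 1 [MOD q]

open scoped Classical in
/-- The indicator function of the integers composed of primes `p ≠ q`, `p ≢ 1 (mod q)`. -/
noncomputable def nonSplitIndicator (q : ℕ) : ArithmeticFunction ℝ where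
  toFun n := if HasNonSplitFactors q n then 1 else 0
  map_zero' := by simp [HasNonSplitFactors]

/-- The function with Dirichlet series `1 + q⁻ˢ`, the Euler factor of `totientIndicator q`
at `q`. -/
noncomputable def oneAddSingle (q : ℕ) : ArithmeticFunction ℝ where
  toFun n := if n = 0 then 0 else if n = 1 ∨ n = q then 1 else 0
  map_zero' := by simp

/-- The function with Dirichlet series `log q / (q ˢ + 1)`, minus the logarithmic derivative of
`1 + q⁻ˢ`: its value at `q ^ k` is `(-1) ^ (k - 1) * log q` for `k ≥ 1`. -/
noncomputable def alternatingLog (q : ℕ) : ArithmeticFunction ℝ where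
  toFun n := if IsPrimePow n ∧ q ∣ n then (-1) ^ (padicValNat q n + 1) * Real.log q else 0
  map_zero' := by simp [not_isPrimePow_zero]

theorem pmul_log_mul (f g : ArithmeticFunction ℝ) :
    (f * g).pmul log = f.pmul log * g + f * g.pmul log := by
  ext n
  rw [pmul_apply, ArithmeticFunction.add_apply, mul_apply, mul_apply, mul_apply,
    Finset.sum_mul, ← Finset.sum_add_distrib]
  refine Finset.sum_congr rfl fun x hx => ?_
  obtain ⟨hx1, hx0⟩ := Nat.mem_divisorsAntidiagonal.1 hx
  subst hx1
  have h1 : (x.1 : ℝ) ≠ 0 := by exact_mod_cast left_ne_zero_of_mul hx0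
  have h2 : (x.2 : ℝ) ≠ 0 := by exact_mod_cast right_ne_zero_of_mul hx0
  simp only [pmul_apply, log_apply]
  rw [Nat.cast_mul, Real.log_mul h1 h2]
  ring

variable {q : ℕ}

theorem hasNonSplitFactors_mul_iff {m n : ℕ} :
    HasNonSplitFactors q (m * n) ↔ HasNonSplitFactors q m ∧ HasNonSplitFactors q n := by
  constructor
  · rintro ⟨h0, h⟩
    exact ⟨⟨left_ne_zero_of_mul h0, fun p hp hd => h p hp (hd.mul_right n)⟩,
      right_ne_zero_of_mul h0, fun p hp hd => h p hp (hd.mul_left m)⟩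
  · rintro ⟨⟨h0, h⟩, h0', h'⟩
    refine ⟨mul_ne_zero h0 h0', fun p hp hd => ?_⟩
    rcases hp.dvd_mul.1 hd with hd | hd
    · exact h p hp hd
    · exact h' p hp hd

theorem nonSplitIndicator_mul (m n : ℕ) :
    nonSplitIndicator q (m * n) = nonSplitIndicator q m * nonSplitIndicator q n := by
  simp only [nonSplitIndicator, coe_mk, hasNonSplitFactors_mul_iff]
  by_cases h1 : HasNonSplitFactors q m <;> by_cases h2 : HasNonSplitFactors q n <;>
    simp [h1, h2, hasNonSplitFactors_mul_iff]

theorem nonSplitIndicator_pmul_vonMangoldt_mul :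
    (nonSplitIndicator q).pmul vonMangoldt * nonSplitIndicator q =
      (nonSplitIndicator q).pmul log := by
  ext n
  rw [mul_apply, pmul_apply, log_apply, ← vonMangoldt_sum, Finset.mul_sum,
    Nat.sum_divisorsAntidiagonal
      (fun i j => (nonSplitIndicator q).pmul vonMangoldt i * nonSplitIndicator q j)]
  refine Finset.sum_congr rfl fun d hd => ?_
  obtain ⟨k, rfl⟩ := Nat.dvd_of_mem_divisors hd
  have hd0 : 0 < d := Nat.pos_of_mem_divisors hd
  rw [Nat.mul_div_cancel_left k hd0, nonSplitIndicator_mul, pmul_apply]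
  ring

variable [hq : Fact q.Prime]

theorem mul_oneAddSingle_apply (h : ArithmeticFunction ℝ) {n : ℕ} (hn : n ≠ 0) :
    (h * oneAddSingle q) n = h n + if q ∣ n then h (n / q) else 0 := by
  have hq1 : (1 : ℕ) ≠ q := hq.out.one_lt.ne
  rw [mul_apply, Nat.sum_divisorsAntidiagonal' (fun i j => h i * oneAddSingle q j)]
  have h1 : ∀ d ∈ n.divisors, h (n / d) * oneAddSingle q d =
      if d = 1 ∨ d = q then h (n / d) else 0 := by
    intro d hd
    have := (Nat.pos_of_mem_divisors hd).ne'
    simp only [oneAddSingle, coe_mk, if_neg this, mul_ite, mul_one, mul_zero]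
  rw [Finset.sum_congr rfl h1, ← Finset.sum_filter]
  by_cases hd : q ∣ n
  · have : n.divisors.filter (fun d => d = 1 ∨ d = q) = {1, q} := by
      ext d
      simp only [Finset.mem_filter, Nat.mem_divisors, Finset.mem_insert, Finset.mem_singleton]
      constructor
      · exact fun h => h.2
      · rintro (rfl | rfl)
        · exact ⟨⟨one_dvd _, hn⟩, Or.inl rfl⟩
        · exact ⟨⟨hd, hn⟩, Or.inr rfl⟩
    rw [this, Finset.sum_pair hq1, Nat.div_one, if_pos hd]
  · have : n.divisors.filter (fun d => d = 1 ∨ d = q) = {1} := by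
      ext d
      simp only [Finset.mem_filter, Nat.mem_divisors, Finset.mem_singleton]
      constructor
      · rintro ⟨⟨h3, _⟩, h2 | h2⟩
        · exact h2
        · exact absurd (h2 ▸ h3) hd
      · rintro rfl
        exact ⟨⟨one_dvd _, hn⟩, Or.inl rfl⟩
    rw [this, Finset.sum_singleton, Nat.div_one, if_neg hd, add_zero]

theorem dvd_totient_iff_of_not_dvd {n : ℕ} (hn : ¬ q ∣ n) :
    ¬ q ∣ n.totient ↔ HasNonSplitFactors q n := by
  have hn0 : n ≠ 0 := by
    rintro rfl
    exact hn (dvd_zero q)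
  have hmod : ∀ p : ℕ, p.Prime → (p ≡ 1 [MOD q] ↔ q ∣ p - 1) := fun p hp => by
    rw [Nat.ModEq.comm, Nat.modEq_iff_dvd' hp.one_le]
  constructor
  · intro h
    refine ⟨hn0, fun p hp hd => ⟨?_, fun h1 => h ?_⟩⟩
    · rintro rfl
      exact hn hd
    · exact ((hmod p hp).1 h1).trans (Nat.totient_prime hp ▸ Nat.totient_dvd_of_dvd hd)
  · rintro ⟨-, h⟩ hd
    rw [Nat.totient_eq_prod_factorization hn0, Finsupp.prod, hq.out.prime.dvd_finsetProd_iff] at hd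
    obtain ⟨p, hp, hd⟩ := hd
    rw [Nat.support_factorization, Nat.mem_primeFactors] at hp
    obtain ⟨hp1, hp2⟩ := h p hp.1 hp.2.1
    rcases hq.out.dvd_mul.1 hd with hd | hd
    · exact hp1 ((Nat.prime_dvd_prime_iff_eq hq.out hp.1).1 (hq.out.dvd_of_dvd_pow hd)).symm
    · exact hp2 ((hmod p hp.1).2 hd)

/-- The Euler product of `totientIndicator q`. -/
theorem totientIndicator_eq_mul :
    totientIndicator q = nonSplitIndicator q * oneAddSingle q := by
  ext n
  rcases eq_or_ne n 0 with rfl | hn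
  · simp
  have hq1 : ¬ q ∣ q - 1 := fun h => by
    have := Nat.le_of_dvd (by have := hq.out.two_le; omega) h
    have := hq.out.pos
    omega
  rw [mul_oneAddSingle_apply _ hn]
  simp only [totientIndicator, nonSplitIndicator, coe_mk]
  by_cases hd : q ∣ n
  · obtain ⟨m, rfl⟩ := hd
    have h1 : ¬ HasNonSplitFactors q (q * m) := fun h => (h.2 q hq.out (dvd_mul_right q m)).1 rfl
    rw [if_neg h1, zero_add, if_pos (dvd_mul_right q m), Nat.mul_div_cancel_left m hq.out.pos]
    by_cases hm : q ∣ m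
    · have h2 : ¬ HasNonSplitFactors q m := fun h => (h.2 q hq.out hm).1 rfl
      rw [if_neg h2, Nat.totient_mul_of_prime_of_dvd hq.out hm, if_pos (dvd_mul_right _ _)]
    · rw [Nat.totient_mul_of_prime_of_not_dvd hq.out hm]
      have h3 : q ∣ (q - 1) * m.totient ↔ ¬ HasNonSplitFactors q m := by
        rw [← dvd_totient_iff_of_not_dvd hm, not_not, hq.out.dvd_mul, or_iff_right hq1]
      by_cases h4 : HasNonSplitFactors q m <;> simp [h3, h4]
  · rw [if_neg hd, add_zero]
    have h3 : q ∣ n.totient ↔ ¬ HasNonSplitFactors q n := by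
      rw [← dvd_totient_iff_of_not_dvd hd, not_not]
    by_cases h4 : HasNonSplitFactors q n <;> simp [h3, h4]

theorem alternatingLog_pow (k : ℕ) :
    alternatingLog q (q ^ (k + 1)) = (-1) ^ k * Real.log q := by
  have h : IsPrimePow (q ^ (k + 1)) := hq.out.isPrimePow.pow k.succ_ne_zero
  simp only [alternatingLog, coe_mk, padicValNat.prime_pow]
  rw [if_pos ⟨h, dvd_pow_self q k.succ_ne_zero⟩, pow_succ, pow_succ]
  ring

theorem alternatingLog_eq_zero {n : ℕ} (h : ∀ k, n ≠ q ^ (k + 1)) : alternatingLog q n = 0 := by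
  simp only [alternatingLog, coe_mk]
  refine if_neg ?_
  rintro ⟨h1, h2⟩
  obtain ⟨p, k, hp, hk, rfl⟩ := (isPrimePow_nat_iff n).1 h1
  have := (Nat.prime_dvd_prime_iff_eq hq.out hp).1 (hq.out.dvd_of_dvd_pow h2)
  subst this
  obtain ⟨j, rfl⟩ := Nat.exists_eq_succ_of_ne_zero hk.ne'
  exact h j rfl

theorem alternatingLog_mul_oneAddSingle :
    alternatingLog q * oneAddSingle q = (oneAddSingle q).pmul log := by
  ext n
  rcases eq_or_ne n 0 with rfl | hn
  · simp
  rw [mul_oneAddSingle_apply _ hn, pmul_apply, log_apply]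
  have hv : oneAddSingle q n = if n = 1 ∨ n = q then 1 else 0 := by
    simp only [oneAddSingle, coe_mk, if_neg hn]
  rw [hv]
  by_cases hd : q ∣ n
  · obtain ⟨m, rfl⟩ := hd
    rw [if_pos (dvd_mul_right q m), Nat.mul_div_cancel_left m hq.out.pos]
    by_cases hm : ∃ k, m = q ^ k
    · obtain ⟨k, rfl⟩ := hm
      rw [← pow_succ', alternatingLog_pow]
      rcases k with _ | k
      · rw [alternatingLog_eq_zero (n := q ^ 0)]
        · simp
        · intro k h
          rw [pow_zero] at h
          exact (Nat.one_lt_pow k.succ_ne_zero hq.out.one_lt).ne h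
      · rw [alternatingLog_pow, if_neg]
        · ring
        · rintro (h | h)
          · exact (Nat.one_lt_pow (by omega) hq.out.one_lt).ne' h
          · have := Nat.pow_right_injective hq.out.two_le (h.trans (pow_one q).symm)
            omega
    · push Not at hm
      rw [alternatingLog_eq_zero (fun k => hm _), alternatingLog_eq_zero, if_neg]
      · simp
      · rintro (h | h)
        · exact hq.out.one_lt.ne' (Nat.eq_one_of_mul_eq_one_right h)
        · exact hm 0 (by simpa using Nat.eq_of_mul_eq_mul_left hq.out.pos (h.trans (mul_one q).symm))
      · intro k h
        rw [pow_succ'] at h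
        exact hm k (Nat.eq_of_mul_eq_mul_left hq.out.pos h)
  · rw [if_neg hd, alternatingLog_eq_zero]
    · split_ifs with h
      · rcases h with rfl | rfl
        · simp
        · exact absurd dvd_rfl hd
      · simp
    · rintro k rfl
      exact hd (dvd_pow_self q k.succ_ne_zero)

/-- The generalized von Mangoldt function of `totientIndicator q`, read off its Euler product. -/
theorem vonMangoldtOf_totientIndicator :
    vonMangoldtOf (totientIndicator q) =
      (nonSplitIndicator q).pmul vonMangoldt + alternatingLog q := by
  have h1 : totientIndicator q 1 = 1 := by
    simp [totientIndicator, hq.out.ne_one]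
  have hu : IsUnit (totientIndicator q) := by
    rw [isUnit_iff_isUnit_apply_one, h1]
    exact isUnit_one
  refine hu.mul_right_cancel ?_
  rw [vonMangoldtOf_mul_self _ h1, totientIndicator_eq_mul, pmul_log_mul,
    ← nonSplitIndicator_pmul_vonMangoldt_mul, ← alternatingLog_mul_oneAddSingle]
  ring

theorem HasSum.tendsto_summatory {f : ℕ → ℝ} {S : ℝ} (hf : HasSum f S) (h0 : f 0 = 0) :
    Tendsto (summatory f) atTop (𝓝 S) := by
  have := hf.tendsto_sum_nat.comp ((tendsto_add_atTop_nat 1).comp tendsto_nat_floor_atTop (α := ℝ))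
  refine this.congr fun x => ?_
  rw [Function.comp_apply, Function.comp_apply, summatory, Finset.range_eq_Ico,
    Finset.sum_eq_sum_Ico_succ_bot (Nat.succ_pos _), h0, _root_.zero_add]
  rfl

theorem hasSum_alternatingLog_div :
    HasSum (fun n => alternatingLog q n / n) (Real.log q / (q + 1)) := by
  have hq0 : (0 : ℝ) < q := by exact_mod_cast hq.out.pos
  have hq1 : (1 : ℝ) < q := by exact_mod_cast hq.out.one_lt
  have hinj : Function.Injective fun k : ℕ => q ^ (k + 1) := fun k l h =>
    Nat.succ_injective (Nat.pow_right_injective hq.out.two_le h)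
  refine (hinj.hasSum_iff fun n hn => ?_).1 ?_
  · rw [alternatingLog_eq_zero fun k h => hn ⟨k, h.symm⟩, zero_div]
  · have hgeo := (hasSum_geometric_of_abs_lt_one (r := -(q : ℝ)⁻¹)
      (by rw [abs_neg, abs_of_pos (by positivity)]; exact inv_lt_one_of_one_lt₀ hq1)).mul_left
      (Real.log q / q)
    convert! hgeo using 1
    · funext k
      simp only [Function.comp_apply, alternatingLog_pow]
      rw [show (-(q : ℝ)⁻¹) ^ k = (-1) ^ k * ((q : ℝ) ^ k)⁻¹ by rw [neg_pow, inv_pow]]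
      push_cast
      field_simp
      ring
    · have : 1 - -(q : ℝ)⁻¹ ≠ 0 := by
        have : 0 < (q : ℝ)⁻¹ := by positivity
        linarith
      field_simp
      ring

end

/-! ### Summation of the generalized von Mangoldt function -/

section

open ArithmeticFunction

variable {q : ℕ}

/-- The von Mangoldt function restricted to the prime powers `p ^ k ≡ 1 (mod q)` with
`p ≢ 1 (mod q)`. -/
noncomputable def nonSplitOne (q n : ℕ) : ℝ :=
  if (n : ZMod q) = 1 then nonSplitIndicator q n * vonMangoldt n else 0

theorem natCast_zmod_eq_one_iff {p : ℕ} : (p : ZMod q) = 1 ↔ p ≡ 1 [MOD q] := by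
  rw [← Nat.cast_one, ZMod.natCast_eq_natCast_iff]

theorem nonSplitIndicator_prime_pow {p : ℕ} (hp : p.Prime) (h1 : p ≠ q) (h2 : ¬ p ≡ 1 [MOD q])
    (k : ℕ) : nonSplitIndicator q (p ^ k) = 1 := by
  simp only [nonSplitIndicator, coe_mk]
  refine if_pos ⟨pow_ne_zero k hp.ne_zero, fun r hr hd => ?_⟩
  have := (Nat.prime_dvd_prime_iff_eq hr hp).1 (hr.dvd_of_dvd_pow hd)
  subst this
  exact ⟨h1, h2⟩

theorem primeTerm_nonneg {p : ℕ} (hp : 1 ≤ p) : 0 ≤ primeTerm q p := by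
  have h1 : (1 : ℝ) ≤ p := by exact_mod_cast hp
  exact div_nonneg (Real.log_nonneg h1) (sub_nonneg.2 (one_le_pow₀ h1))

variable [hq : Fact q.Prime]

theorem nonSplitIndicator_mul_vonMangoldt (n : ℕ) :
    nonSplitIndicator q n * vonMangoldt n =
      ∑ a ∈ ({0, 1}ᶜ : Finset (ZMod q)), vonMangoldt.residueClass a n + nonSplitOne q n := by
  have hsum : ∑ a ∈ ({0, 1}ᶜ : Finset (ZMod q)), vonMangoldt.residueClass a n =
      if (n : ZMod q) ∈ ({0, 1}ᶜ : Finset (ZMod q)) then vonMangoldt n else 0 := by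
    rw [← Finset.sum_ite_eq ({0, 1}ᶜ : Finset (ZMod q)) (n : ZMod q) (fun _ => vonMangoldt n)]
    refine Finset.sum_congr rfl fun a _ => ?_
    simp only [vonMangoldt.residueClass, Set.indicator_apply, Set.mem_ofPred_eq]
  rw [hsum, nonSplitOne]
  simp only [Finset.mem_compl, Finset.mem_insert, Finset.mem_singleton, not_or]
  by_cases h1 : (n : ZMod q) = 1
  · simp [h1]
  by_cases h0 : (n : ZMod q) = 0
  · have hd : q ∣ n := (ZMod.natCast_eq_zero_iff n q).1 h0
    have : ¬ HasNonSplitFactors q n := fun h => (h.2 q hq.out hd).1 rfl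
    simp [nonSplitIndicator, this, h0]
  · rw [if_pos ⟨h0, h1⟩, if_neg h1, _root_.add_zero]
    by_cases hpp : IsPrimePow n
    · obtain ⟨p, k, hp, hk, rfl⟩ := (isPrimePow_nat_iff n).1 hpp
      rw [nonSplitIndicator_prime_pow hp, one_mul]
      · rintro rfl
        exact h0 (by simp [hk.ne'])
      · intro h
        exact h1 (by rw [Nat.cast_pow, natCast_zmod_eq_one_iff.2 h, one_pow])
    · rw [vonMangoldt_eq_zero_iff.2 hpp, mul_zero]

theorem orderOf_pos_of_ne {p : ℕ} (hp : p.Prime) (h1 : p ≠ q) : 0 < orderOf (p : ZMod q) := by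
  have h0 : (p : ZMod q) ≠ 0 := fun h => by
    rw [ZMod.natCast_eq_zero_iff, Nat.prime_dvd_prime_iff_eq hq.out hp] at h
    exact h1 h.symm
  rw [orderOf_pos_iff, isOfFinOrder_iff_pow_eq_one]
  exact ⟨q - 1, by have := hq.out.two_le; omega, ZMod.pow_card_sub_one_eq_one h0⟩

theorem two_le_orderOf (p : NonSplitPrime q) : 2 ≤ orderOf ((p : ℕ) : ZMod q) := by
  obtain ⟨p, hp, h1, h2⟩ := p
  have := orderOf_pos_of_ne hp h1
  have : orderOf (p : ZMod q) ≠ 1 := by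
    rw [Ne, orderOf_eq_one_iff, natCast_zmod_eq_one_iff]
    exact h2
  simp only
  omega

/-- The series converges because the residue degrees occurring in it are at least two. -/
theorem summable_primeTerm : Summable fun p : NonSplitPrime q => primeTerm q p := by
  have h1 : Summable fun n : ℕ => 4 * (n : ℝ) ^ (-(3 / 2 : ℝ)) :=
    (Real.summable_nat_rpow.2 (by norm_num)).mul_left 4
  have h2 : Summable fun p : NonSplitPrime q => 4 * ((p : ℕ) : ℝ) ^ (-(3 / 2 : ℝ)) :=
    h1.comp_injective Subtype.val_injective
  refine h2.of_nonneg_of_le (fun p => primeTerm_nonneg p.2.1.one_le) fun p => ?_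
  have hp : (2 : ℝ) ≤ ((p : ℕ) : ℝ) := by exact_mod_cast p.2.1.two_le
  have hp0 : (0 : ℝ) < ((p : ℕ) : ℝ) := by linarith
  set x : ℝ := ((p : ℕ) : ℝ)
  have hlog : Real.log x ≤ x ^ (1 / 2 : ℝ) / (1 / 2) :=
    Real.log_le_rpow_div hp0.le (by norm_num)
  have hpow : x ^ 2 ≤ x ^ orderOf ((p : ℕ) : ZMod q) :=
    pow_le_pow_right₀ (by linarith) (two_le_orderOf p)
  have hden : x ^ 2 / 2 ≤ x ^ orderOf ((p : ℕ) : ZMod q) - 1 := by nlinarith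
  have hx2 : 0 < x ^ 2 / 2 := by positivity
  calc primeTerm q p ≤ (x ^ (1 / 2 : ℝ) / (1 / 2)) / (x ^ 2 / 2) := by
        unfold primeTerm
        exact div_le_div₀ (by positivity) hlog hx2 hden
    _ = 4 * (x ^ (1 / 2 : ℝ) / x ^ (2 : ℝ)) := by
        rw [Real.rpow_two]
        field_simp
        norm_num
    _ = _ := by
        rw [← Real.rpow_sub hp0]
        norm_num

theorem injective_nonSplit_pow : Function.Injective fun x : NonSplitPrime q × ℕ =>
    (x.1 : ℕ) ^ (orderOf ((x.1 : ℕ) : ZMod q) * (x.2 + 1)) := by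
  rintro ⟨p, j⟩ ⟨r, k⟩ h
  have hp := two_le_orderOf p
  have hr := two_le_orderOf r
  simp only at h
  have hpr : p = r := by
    have hd : (p : ℕ) ∣ (r : ℕ) ^ (orderOf ((r : ℕ) : ZMod q) * (k + 1)) :=
      h ▸ dvd_pow_self _ (by positivity)
    exact Subtype.ext ((Nat.prime_dvd_prime_iff_eq p.2.1 r.2.1).1 (p.2.1.dvd_of_dvd_pow hd))
  subst hpr
  have := Nat.pow_right_injective p.2.1.two_le h
  have := Nat.eq_of_mul_eq_mul_left (by omega) this
  simp at this
  rw [this]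

theorem hasSum_nonSplitOne_div :
    HasSum (fun n => nonSplitOne q n / n) (∑' p : NonSplitPrime q, primeTerm q p) := by
  refine ((injective_nonSplit_pow (q := q)).hasSum_iff fun n hn => ?_).1 ?_
  · rw [nonSplitOne]
    split_ifs with h1
    · by_cases hpp : IsPrimePow n
      · obtain ⟨p, k, hp, hk, rfl⟩ := (isPrimePow_nat_iff n).1 hpp
        suffices h : ¬ HasNonSplitFactors q (p ^ k) by simp [nonSplitIndicator, h]
        intro h
        have h2 := h.2 p hp (dvd_pow_self p hk.ne')
        rw [Nat.cast_pow, ← orderOf_dvd_iff_pow_eq_one] at h1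
        obtain ⟨j, rfl⟩ := h1
        have hj : j ≠ 0 := by
          rintro rfl
          simp at hk
        refine hn ⟨(⟨p, hp, h2⟩, j - 1), ?_⟩
        simp only
        rw [Nat.sub_add_cancel (by omega)]
      · rw [vonMangoldt_eq_zero_iff.2 hpp, mul_zero, zero_div]
    · rw [zero_div]
  · have hterm : ∀ x : NonSplitPrime q × ℕ, ((fun n : ℕ => nonSplitOne q n / n) ∘
        fun x : NonSplitPrime q × ℕ => (x.1 : ℕ) ^ (orderOf ((x.1 : ℕ) : ZMod q) * (x.2 + 1))) x =
        Real.log (x.1 : ℕ) * ((((x.1 : ℕ) : ℝ) ^ orderOf ((x.1 : ℕ) : ZMod q))⁻¹) ^ (x.2 + 1) := by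
      rintro ⟨p, j⟩
      have hp := two_le_orderOf p
      have h1 : (((p : ℕ) ^ (orderOf ((p : ℕ) : ZMod q) * (j + 1)) : ℕ) : ZMod q) = 1 := by
        rw [Nat.cast_pow, pow_mul, pow_orderOf_eq_one, one_pow]
      simp only [Function.comp_apply, nonSplitOne]
      rw [if_pos h1, nonSplitIndicator_prime_pow p.2.1 p.2.2.1 p.2.2.2, one_mul,
        vonMangoldt_apply_pow (by positivity), vonMangoldt_apply_prime p.2.1]
      push_cast
      rw [pow_mul, inv_pow, div_eq_mul_inv]
    have hgeo : ∀ p : NonSplitPrime q, HasSum (fun j : ℕ => Real.log (p : ℕ) *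
        ((((p : ℕ) : ℝ) ^ orderOf ((p : ℕ) : ZMod q))⁻¹) ^ (j + 1)) (primeTerm q p) := by
      intro p
      have hp : (1 : ℝ) < ((p : ℕ) : ℝ) := by exact_mod_cast p.2.1.one_lt
      have hpow : 1 < ((p : ℕ) : ℝ) ^ orderOf ((p : ℕ) : ZMod q) :=
        one_lt_pow₀ hp (by have := two_le_orderOf p; omega)
      set y := ((p : ℕ) : ℝ) ^ orderOf ((p : ℕ) : ZMod q) with hy
      have hy0 : y - 1 ≠ 0 := by linarith
      have := (hasSum_geometric_of_lt_one (r := y⁻¹) (by positivity)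
        (inv_lt_one_of_one_lt₀ hpow)).mul_left (Real.log (p : ℕ) * y⁻¹)
      convert! this using 1
      · funext j
        rw [pow_succ']
        ring
      · rw [primeTerm, ← hy]
        have : y ≠ 0 := by linarith
        field_simp
    have hs : Summable fun x : NonSplitPrime q × ℕ => Real.log (x.1 : ℕ) *
        ((((x.1 : ℕ) : ℝ) ^ orderOf ((x.1 : ℕ) : ZMod q))⁻¹) ^ (x.2 + 1) := by
      rw [summable_prod_of_nonneg]
      · refine ⟨fun p => (hgeo p).summable, ?_⟩
        exact summable_primeTerm.congr fun p => ((hgeo p).tsum_eq).symm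
      · intro x
        have : (1 : ℝ) ≤ ((x.1 : ℕ) : ℝ) := by exact_mod_cast x.1.2.1.one_le
        have := Real.log_nonneg this
        simp only [Pi.zero_apply]
        positivity
    rw [funext hterm]
    have := hs.hasSum
    rwa [hs.tsum_prod' fun p => (hgeo p).summable, tsum_congr fun p => (hgeo p).tsum_eq] at this

/-- The partial sums of `Λ_{f_q}(n) / n`, decomposed into residue classes modulo `q`. -/
theorem vonMangoldtSum_eq (x : ℝ) :
    vonMangoldtSum q x =
      ∑ a ∈ ({0, 1}ᶜ : Finset (ZMod q)), summatory (fun n => vonMangoldt.residueClass a n / n) x +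
        summatory (fun n => nonSplitOne q n / n) x +
        summatory (fun n => alternatingLog q n / n) x := by
  simp only [summatory]
  rw [Finset.sum_comm, ← Finset.sum_add_distrib, ← Finset.sum_add_distrib, vonMangoldtSum]
  refine Finset.sum_congr rfl fun n _ => ?_
  rw [vonMangoldtOf_totientIndicator, ArithmeticFunction.add_apply, pmul_apply,
    nonSplitIndicator_mul_vonMangoldt, ← Finset.sum_div, add_div, add_div]

theorem card_compl_zero_one : (({0, 1}ᶜ : Finset (ZMod q)).card : ℝ) = (q : ℝ) - 2 := by
  rw [Finset.card_compl, ZMod.card, Finset.card_pair zero_ne_one, Nat.cast_sub hq.out.two_le]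
  simp

theorem tendsto_vonMangoldtSum_complex :
    Tendsto (fun x : ℝ => ((vonMangoldtSum q x -
        ((q : ℝ) - 2) / ((q : ℝ) - 1) * Real.log x : ℝ) : ℂ)) atTop
      (𝓝 ((((3 - (q : ℝ)) * Real.log q / (((q : ℝ) - 1) * ((q : ℝ) ^ 2 - 1))
            - ((q : ℝ) - 2) / ((q : ℝ) - 1) * Real.eulerMascheroniConstant : ℝ) : ℂ)
          + 1 / ((q : ℂ) - 1) * sumLogDerivOne q
          + ((∑' p : NonSplitPrime q, primeTerm q p : ℝ) : ℂ))) := by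
  have hq1 : (q : ℂ) - 1 ≠ 0 := by
    rw [sub_ne_zero]
    exact_mod_cast hq.out.one_lt.ne'
  have hq2 : (q : ℂ) + 1 ≠ 0 := by exact_mod_cast q.succ_ne_zero
  have htot : (q.totient : ℝ) = (q : ℝ) - 1 := by
    rw [Nat.totient_prime hq.out, Nat.cast_sub hq.out.one_le, Nat.cast_one]
  have h1 : Tendsto (fun x : ℝ => ∑ a ∈ ({0, 1}ᶜ : Finset (ZMod q)),
      ((summatory (fun n => vonMangoldt.residueClass a n / n) x -
        (q.totient : ℝ)⁻¹ * Real.log x : ℝ) : ℂ)) atTop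
      (𝓝 (∑ a ∈ ({0, 1}ᶜ : Finset (ZMod q)), vonMangoldt.LFunctionResidueClassAux a 1)) := by
    refine tendsto_finsetSum _ fun a ha => tendsto_sum_residueClass_div ?_
    simp only [Finset.mem_compl, Finset.mem_insert, Finset.mem_singleton, not_or] at ha
    exact isUnit_iff_ne_zero.2 ha.1
  have h2 := (Complex.continuous_ofReal.tendsto _).comp
    ((hasSum_nonSplitOne_div (q := q)).tendsto_summatory (by simp))
  have h3 := (Complex.continuous_ofReal.tendsto _).comp
    ((hasSum_alternatingLog_div (q := q)).tendsto_summatory (by simp))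
  rw [sum_LFunctionResidueClassAux_one] at h1
  have h4 := (h1.add h2).add h3
  have e : ((3 - (q : ℂ)) * Real.log q / (((q : ℂ) - 1) * ((q : ℂ) ^ 2 - 1))) =
      Real.log q / ((q : ℂ) + 1) - ((q : ℂ) - 2) * Real.log q / ((q : ℂ) - 1) ^ 2 := by
    have hq3 : (q : ℂ) ^ 2 - 1 ≠ 0 := by
      have : (q : ℂ) ^ 2 - 1 = ((q : ℂ) - 1) * ((q : ℂ) + 1) := by ring
      rw [this]
      exact mul_ne_zero hq1 hq2
    field_simp
    ring
  convert! h4 using 1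
  · funext x
    simp only [Function.comp_apply]
    rw [← Complex.ofReal_sum, ← Complex.ofReal_add, ← Complex.ofReal_add, vonMangoldtSum_eq,
      Finset.sum_sub_distrib, Finset.sum_const, nsmul_eq_mul, card_compl_zero_one, htot]
    congr 1
    ring
  · congr 1
    push_cast
    push_cast at e
    rw [e]
    field_simp
    ring

end

/-! ### Ideals and the von Mangoldt function of a number field -/

section

open ArithmeticFunction NumberField UniqueFactorizationMonoid

variable (K : Type*) [Field K] [NumberField K]

/-- The finite set of ideals of norm `n` of the ring of integers (for `n = 0`, the zero ideal). -/
noncomputable def idealsOfNorm (n : ℕ) : Finset (Ideal (𝓞 K)) :=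
  (Ideal.finite_setOfPred_absNorm_eq (S := 𝓞 K) n).toFinset

open scoped Classical in
/-- The finite set of primes of the ring of integers that divide the natural number `n ≠ 0`. -/
noncomputable def primesDividing (n : ℕ) : Finset (Ideal (𝓞 K)) :=
  (normalizedFactors (Ideal.span {(n : 𝓞 K)})).toFinset

/-- The coefficients of `-ζ_K' / ζ_K`: the sum of `log N(P)` over all prime powers `P ^ k`, `k ≥ 1`,
of norm `n`. Both ranges of summation are finite sets large enough to contain all solutions of
`N(P) ^ k = n`. -/
noncomputable def idealVonMangoldt (n : ℕ) : ℝ :=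
  ∑ P ∈ primesDividing K n, ∑ k ∈ Finset.Icc 1 n,
    if Ideal.absNorm P ^ k = n then Real.log (Ideal.absNorm P) else 0

variable {K}

theorem mem_idealsOfNorm {n : ℕ} {I : Ideal (𝓞 K)} :
    I ∈ idealsOfNorm K n ↔ Ideal.absNorm I = n := by
  simp [idealsOfNorm]

theorem card_idealsOfNorm (n : ℕ) :
    (idealsOfNorm K n).card = Nat.card {I : Ideal (𝓞 K) // Ideal.absNorm I = n} := by
  rw [idealsOfNorm, ← Set.ncard_eq_toFinset_card _ (Ideal.finite_setOfPred_absNorm_eq n),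
    ← Nat.card_coe_set_eq]
  rfl

theorem mem_primesDividing {n : ℕ} (hn : n ≠ 0) {P : Ideal (𝓞 K)} :
    P ∈ primesDividing K n ↔ P.IsPrime ∧ (n : 𝓞 K) ∈ P := by
  have h0 : Ideal.span {(n : 𝓞 K)} ≠ ⊥ := by
    simpa using hn
  rw [primesDividing, Multiset.mem_toFinset, Ideal.mem_normalizedFactors_iff h0,
    Ideal.span_singleton_le_iff_mem]

theorem ne_bot_of_mem_primesDividing {n : ℕ} (hn : n ≠ 0) {P : Ideal (𝓞 K)}
    (hP : P ∈ primesDividing K n) : P ≠ ⊥ := by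
  rintro rfl
  have := ((mem_primesDividing hn).1 hP).2
  simp [hn] at this

theorem two_le_absNorm {P : Ideal (𝓞 K)} (hP : P.IsPrime) (h0 : P ≠ ⊥) : 2 ≤ Ideal.absNorm P := by
  have h1 : Ideal.absNorm P ≠ 0 := fun h => h0 (Ideal.absNorm_eq_zero_iff.1 h)
  have h2 : Ideal.absNorm P ≠ 1 := fun h => hP.ne_top (Ideal.absNorm_eq_one_iff.1 h)
  omega

theorem pow_dvd_iff_le_count [DecidableEq (Ideal (𝓞 K))] {P I : Ideal (𝓞 K)} (hP : P.IsPrime)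
    (h0 : P ≠ ⊥) (hI : I ≠ ⊥) (k : ℕ) : P ^ k ∣ I ↔ k ≤ (normalizedFactors I).count P := by
  have hp : Irreducible P := (Ideal.prime_of_isPrime h0 hP).irreducible
  rw [dvd_iff_normalizedFactors_le_normalizedFactors (pow_ne_zero k h0) hI,
    normalizedFactors_pow, normalizedFactors_irreducible hp, normalize_eq,
    Multiset.nsmul_singleton, Multiset.le_count_iff_replicate_le]

theorem sum_Icc_ite_le {n m : ℕ} (h : m ≤ n) (c : ℝ) :
    ∑ k ∈ Finset.Icc 1 n, (if k ≤ m then c else 0) = m * c := by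
  rw [← Finset.sum_filter]
  have : (Finset.Icc 1 n).filter (fun k => k ≤ m) = Finset.Icc 1 m := by
    ext k
    simp only [Finset.mem_filter, Finset.mem_Icc]
    omega
  rw [this, Finset.sum_const, Nat.card_Icc, nsmul_eq_mul]
  simp

/-- Unique factorization of an ideal `I`, in logarithmic form: `log N(I)` is the sum of `log N(P)`
over the prime powers dividing `I`. -/
theorem log_eq_sum_primesDividing {n : ℕ} (hn : n ≠ 0) {I : Ideal (𝓞 K)}
    (hI : Ideal.absNorm I = n) [DecidablePred fun J : Ideal (𝓞 K) => J ∣ I] :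
    Real.log n = ∑ P ∈ primesDividing K n, ∑ k ∈ Finset.Icc 1 n,
      if P ^ k ∣ I then Real.log (Ideal.absNorm P) else 0 := by
  classical
  have hI0 : I ≠ ⊥ := by
    rintro rfl
    simp at hI
    exact hn hI.symm
  have hterm : ∀ P ∈ primesDividing K n, (∑ k ∈ Finset.Icc 1 n,
      if P ^ k ∣ I then Real.log (Ideal.absNorm P) else 0) =
      (normalizedFactors I).count P * Real.log (Ideal.absNorm P) := by
    intro P hP
    have h0 := ne_bot_of_mem_primesDividing hn hP
    have hPp := ((mem_primesDividing hn).1 hP).1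
    rw [← sum_Icc_ite_le (n := n)]
    · refine Finset.sum_congr rfl fun k _ => ?_
      simp only [pow_dvd_iff_le_count hPp h0 hI0]
    · have h1 : P ^ (normalizedFactors I).count P ∣ I :=
        (pow_dvd_iff_le_count hPp h0 hI0 _).2 le_rfl
      have h2 := Nat.le_of_dvd (Nat.pos_of_ne_zero hn) (hI ▸ map_dvd Ideal.absNorm h1)
      rw [map_pow] at h2
      have h3 := Nat.pow_le_pow_left (two_le_absNorm hPp h0) ((normalizedFactors I).count P)
      have h4 := Nat.lt_two_pow_self (n := (normalizedFactors I).count P)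
      omega
  rw [Finset.sum_congr rfl hterm]
  have hsub : (normalizedFactors I).toFinset ⊆ primesDividing K n := by
    intro P hP
    rw [Multiset.mem_toFinset, Ideal.mem_normalizedFactors_iff hI0] at hP
    rw [mem_primesDividing hn]
    exact ⟨hP.1, hP.2 (hI ▸ Ideal.absNorm_mem I)⟩
  rw [← Finset.sum_subset hsub]
  · have hprod : Ideal.absNorm I = ∏ P ∈ (normalizedFactors I).toFinset,
        Ideal.absNorm P ^ (normalizedFactors I).count P := by
      conv_lhs => rw [← Ideal.prod_normalizedFactors_eq_self hI0, Finset.prod_multiset_count]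
      rw [map_prod]
      simp only [map_pow]
    rw [← hI, hprod, Nat.cast_prod, Real.log_prod]
    · refine Finset.sum_congr rfl fun P _ => ?_
      rw [Nat.cast_pow, Real.log_pow]
    · intro P hP
      have h0 := ne_bot_of_mem_primesDividing hn (hsub hP)
      have : Ideal.absNorm P ≠ 0 := fun h => h0 (Ideal.absNorm_eq_zero_iff.1 h)
      positivity
  · intro P _ hP
    rw [Multiset.mem_toFinset, ← Multiset.count_eq_zero] at hP
    simp [hP]

open scoped Classical in
/-- The ideals of norm `n` divisible by `Q` correspond to the ideals of norm `n / N(Q)`. -/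
theorem card_filter_dvd_idealsOfNorm (n : ℕ) {Q : Ideal (𝓞 K)} (hQ : Q ≠ ⊥) :
    ((idealsOfNorm K n).filter fun I => Q ∣ I).card =
      if Ideal.absNorm Q ∣ n then (idealsOfNorm K (n / Ideal.absNorm Q)).card else 0 := by
  have hN : 0 < Ideal.absNorm Q :=
    Nat.pos_of_ne_zero fun h => hQ (Ideal.absNorm_eq_zero_iff.1 h)
  split_ifs with h
  · symm
    refine Finset.card_bij (fun J _ => Q * J) ?_ ?_ ?_
    · intro J hJ
      rw [mem_idealsOfNorm] at hJ
      rw [Finset.mem_filter, mem_idealsOfNorm, map_mul, hJ, Nat.mul_div_cancel' h]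
      exact ⟨rfl, dvd_mul_right _ _⟩
    · intro J _ J' _ h
      exact mul_left_cancel₀ hQ h
    · intro I hI
      rw [Finset.mem_filter, mem_idealsOfNorm] at hI
      obtain ⟨h1, J, rfl⟩ := hI
      refine ⟨J, ?_, rfl⟩
      rw [mem_idealsOfNorm, ← h1, map_mul, Nat.mul_div_cancel_left _ hN]
  · rw [Finset.card_eq_zero, Finset.filter_eq_empty_iff]
    intro I hI hd
    rw [mem_idealsOfNorm] at hI
    exact h (hI ▸ map_dvd Ideal.absNorm hd)

theorem idealVonMangoldt_eq_of_dvd {n e : ℕ} (hn : n ≠ 0) (he : e ∣ n) :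
    idealVonMangoldt K e = ∑ P ∈ primesDividing K n, ∑ k ∈ Finset.Icc 1 n,
      if Ideal.absNorm P ^ k = e then Real.log (Ideal.absNorm P) else 0 := by
  have he0 : e ≠ 0 := by
    rintro rfl
    exact hn (zero_dvd_iff.1 he)
  have hle : e ≤ n := Nat.le_of_dvd (Nat.pos_of_ne_zero hn) he
  rw [idealVonMangoldt]
  have hsub : primesDividing K e ⊆ primesDividing K n := by
    intro P hP
    rw [mem_primesDividing he0] at hP
    rw [mem_primesDividing hn]
    obtain ⟨m, rfl⟩ := he
    refine ⟨hP.1, ?_⟩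
    rw [Nat.cast_mul]
    exact P.mul_mem_right _ hP.2
  rw [← Finset.sum_subset hsub]
  · refine Finset.sum_congr rfl fun P hP => ?_
    refine Finset.sum_subset (Finset.Icc_subset_Icc_right hle) fun k hk hk' => ?_
    refine if_neg fun h => hk' ?_
    rw [Finset.mem_Icc] at hk ⊢
    refine ⟨hk.1, ?_⟩
    have h3 := Nat.pow_le_pow_left (two_le_absNorm ((mem_primesDividing he0).1 hP).1
      (ne_bot_of_mem_primesDividing he0 hP)) k
    have h4 := Nat.lt_two_pow_self (n := k)
    omega
  · intro P hP hP'
    refine Finset.sum_eq_zero fun k hk => if_neg fun h => hP' ?_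
    rw [mem_primesDividing he0]
    refine ⟨((mem_primesDividing hn).1 hP).1, ?_⟩
    rw [← h, Nat.cast_pow]
    rw [Finset.mem_Icc] at hk
    exact P.pow_mem_of_mem (Ideal.absNorm_mem P) k (by omega)

/-- The Dirichlet convolution identity behind `-ζ_K' = ζ_K · (-ζ_K' / ζ_K)`. -/
theorem log_mul_card_idealsOfNorm {n : ℕ} (hn : n ≠ 0) :
    Real.log n * (idealsOfNorm K n).card =
      ∑ x ∈ n.divisorsAntidiagonal, (idealsOfNorm K x.1).card * idealVonMangoldt K x.2 := by
  classical
  have hl : Real.log n * (idealsOfNorm K n).card = ∑ P ∈ primesDividing K n,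
      ∑ k ∈ Finset.Icc 1 n, Real.log (Ideal.absNorm P) *
        if Ideal.absNorm P ^ k ∣ n then
          ((idealsOfNorm K (n / Ideal.absNorm P ^ k)).card : ℝ) else 0 := by
    have h1 : Real.log n * (idealsOfNorm K n).card = ∑ I ∈ idealsOfNorm K n,
        ∑ P ∈ primesDividing K n, ∑ k ∈ Finset.Icc 1 n,
          if P ^ k ∣ I then Real.log (Ideal.absNorm P) else 0 := by
      rw [mul_comm, ← nsmul_eq_mul, ← Finset.sum_const]
      exact Finset.sum_congr rfl fun I hI =>
        log_eq_sum_primesDividing hn (mem_idealsOfNorm.1 hI)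
    rw [h1, Finset.sum_comm]
    refine Finset.sum_congr rfl fun P hP => ?_
    rw [Finset.sum_comm]
    refine Finset.sum_congr rfl fun k _ => ?_
    have h2 := card_filter_dvd_idealsOfNorm n (Q := P ^ k)
      (pow_ne_zero k (ne_bot_of_mem_primesDividing hn hP))
    rw [map_pow] at h2
    rw [← Finset.sum_filter, Finset.sum_const, h2, nsmul_eq_mul, mul_comm]
    split_ifs <;> simp
  rw [hl, Nat.sum_divisorsAntidiagonal'
    (fun i j => ((idealsOfNorm K i).card : ℝ) * idealVonMangoldt K j)]
  have hr : ∀ e ∈ n.divisors, ((idealsOfNorm K (n / e)).card : ℝ) * idealVonMangoldt K e =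
      ∑ P ∈ primesDividing K n, ∑ k ∈ Finset.Icc 1 n, if Ideal.absNorm P ^ k = e then
        Real.log (Ideal.absNorm P) * (idealsOfNorm K (n / e)).card else 0 := by
    intro e he
    rw [idealVonMangoldt_eq_of_dvd hn (Nat.dvd_of_mem_divisors he), Finset.mul_sum]
    refine Finset.sum_congr rfl fun P _ => ?_
    rw [Finset.mul_sum]
    refine Finset.sum_congr rfl fun k _ => ?_
    rw [mul_ite, mul_zero, mul_comm]
  rw [Finset.sum_congr rfl hr]
  symm
  rw [Finset.sum_comm]
  refine Finset.sum_congr rfl fun P _ => ?_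
  rw [Finset.sum_comm]
  refine Finset.sum_congr rfl fun k _ => ?_
  rw [Finset.sum_ite_eq, mul_ite, mul_zero]
  simp only [Nat.mem_divisors, hn, ne_eq, not_false_eq_true, and_true]

end

/-! ### Splitting of primes in cyclotomic fields -/

section

open ArithmeticFunction NumberField UniqueFactorizationMonoid

theorem liesOver_span_iff {K : Type*} [Field K] {p : ℕ} (hp : p.Prime) {P : Ideal (𝓞 K)}
    [P.IsPrime] : P.LiesOver (Ideal.span {(p : ℤ)}) ↔ (p : 𝓞 K) ∈ P := by
  have : Fact p.Prime := ⟨hp⟩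
  rw [Ideal.liesOver_iff]
  constructor
  · intro h
    have h1 : (p : ℤ) ∈ Ideal.under ℤ P := h ▸ Ideal.mem_span_singleton_self _
    rw [Ideal.under_def, Ideal.mem_comap] at h1
    simpa using h1
  · intro h
    refine Ideal.IsMaximal.eq_of_le (Int.ideal_span_isMaximal_of_prime p) Ideal.IsPrime.ne_top' ?_
    rw [Ideal.span_singleton_le_iff_mem, Ideal.under_def, Ideal.mem_comap]
    simpa using h

variable {K : Type*} [Field K] [NumberField K]

theorem coe_primesDividing_prime_pow {p m : ℕ} (hp : p.Prime) (hm : m ≠ 0) :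
    (primesDividing K (p ^ m) : Set (Ideal (𝓞 K))) =
      (Ideal.span {(p : ℤ)}).primesOver (𝓞 K) := by
  ext P
  rw [Finset.mem_coe, mem_primesDividing (pow_ne_zero m hp.ne_zero), Nat.cast_pow]
  change _ ↔ P.IsPrime ∧ P.LiesOver _
  refine and_congr_right fun hP => ?_
  rw [liesOver_span_iff hp, hP.pow_mem_iff_mem m (Nat.pos_of_ne_zero hm)]

theorem idealVonMangoldt_prime_pow {p m f : ℕ} (hp : p.Prime) (hm : m ≠ 0) (hf0 : f ≠ 0)
    (hf : ∀ P ∈ primesDividing K (p ^ m), Ideal.absNorm P = p ^ f) :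
    idealVonMangoldt K (p ^ m) = ((Ideal.span {(p : ℤ)}).primesOver (𝓞 K)).ncard *
      if f ∣ m then f * Real.log p else 0 := by
  have hterm : ∀ P ∈ primesDividing K (p ^ m), (∑ k ∈ Finset.Icc 1 (p ^ m),
      if Ideal.absNorm P ^ k = p ^ m then Real.log (Ideal.absNorm P) else 0) =
      if f ∣ m then f * Real.log p else 0 := by
    intro P hP
    rw [hf P hP, Nat.cast_pow, Real.log_pow]
    have h1 : ∀ k, (p ^ f) ^ k = p ^ m ↔ f * k = m := fun k => by
      rw [← pow_mul]
      exact (Nat.pow_right_injective hp.two_le).eq_iff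
    simp only [h1]
    split_ifs with h
    · obtain ⟨k, rfl⟩ := h
      have hk : k ∈ Finset.Icc 1 (p ^ (f * k)) := by
        rw [Finset.mem_Icc]
        refine ⟨Nat.one_le_iff_ne_zero.2 (right_ne_zero_of_mul hm), ?_⟩
        exact (Nat.le_mul_of_pos_left k (Nat.pos_of_ne_zero hf0)).trans
          (Nat.lt_pow_self hp.one_lt).le
      simp only [Nat.mul_right_inj hf0]
      rw [Finset.sum_ite_eq_of_mem' _ _ _ hk]
    · exact Finset.sum_eq_zero fun k _ => if_neg fun h' => h ⟨k, h'.symm⟩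
  rw [idealVonMangoldt, Finset.sum_congr rfl hterm, Finset.sum_const, nsmul_eq_mul,
    ← coe_primesDividing_prime_pow hp hm, Set.ncard_coe_finset]

/-- The norm of a prime ideal is a power of the prime number below it. -/
theorem idealVonMangoldt_of_not_isPrimePow {n : ℕ} (hn : n ≠ 0) (h : ¬ IsPrimePow n) :
    idealVonMangoldt K n = 0 := by
  refine Finset.sum_eq_zero fun P hP => Finset.sum_eq_zero fun k hk => if_neg fun hk' => h ?_
  have hP' := ((mem_primesDividing hn).1 hP).1
  have h0 := ne_bot_of_mem_primesDividing hn hP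
  rw [Finset.mem_Icc] at hk
  rw [← hk']
  refine IsPrimePow.pow ?_ (by omega)
  -- the prime number below `P`
  obtain ⟨p, hp, hpP⟩ : ∃ p : ℕ, p.Prime ∧ (p : 𝓞 K) ∈ P := by
    have hprod := Nat.prod_primeFactorsList (n := n) hn
    have hnP := ((mem_primesDividing hn).1 hP).2
    rw [← hprod, Nat.cast_list_prod, ← Multiset.prod_coe,
      hP'.multiset_prod_mem_iff_exists_mem] at hnP
    obtain ⟨x, hx, hxP⟩ := hnP
    obtain ⟨p, hp, rfl⟩ := List.mem_map.1 (Multiset.mem_coe.1 hx)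
    exact ⟨p, Nat.prime_of_mem_primeFactorsList hp, hxP⟩
  have := (liesOver_span_iff hp).2 hpP
  have := Ideal.pow_inertiaDeg p P
  rw [← this]
  refine hp.isPrimePow.pow fun h => ?_
  rw [h, pow_zero] at this
  exact hP'.ne_top (Ideal.absNorm_eq_one_iff.1 this.symm)

/-- The splitting law in the cyclotomic field of prime conductor `q`, in terms of the coefficients
of `-ζ_K' / ζ_K`: an unramified prime `p` has `(q - 1) / f` primes of norm `p ^ f` above it,
where `f` is the order of `p` modulo `q`. -/
theorem idealVonMangoldt_cyclotomic {q : ℕ} [hq : Fact q.Prime] [IsCyclotomicExtension {q} ℚ K]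
    {n : ℕ} (hn : n ≠ 0) : idealVonMangoldt K n =
      if q ∣ n then vonMangoldt n else
        if (n : ZMod q) = 1 then ((q : ℝ) - 1) * vonMangoldt n else 0 := by
  by_cases hpp : IsPrimePow n
  · obtain ⟨p, m, hp, hm, rfl⟩ := (isPrimePow_nat_iff n).1 hpp
    have hpF : Fact p.Prime := ⟨hp⟩
    rw [vonMangoldt_apply_pow hm.ne', vonMangoldt_apply_prime hp]
    by_cases hpq : q = p
    · subst hpq
      rw [if_pos (dvd_pow_self q hm.ne'), idealVonMangoldt_prime_pow (f := 1) hp hm.ne' one_ne_zero,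
        IsCyclotomicExtension.Rat.ncard_primesOver_of_prime]
      · simp
      · intro P hP
        have hP' : P ∈ (Ideal.span {(q : ℤ)}).primesOver (𝓞 K) := by
          rw [← coe_primesDividing_prime_pow hp hm.ne']
          exact hP
        have := hP'.1
        have := hP'.2
        rw [← Ideal.pow_inertiaDeg q P, IsCyclotomicExtension.Rat.inertiaDeg_eq_of_prime q K P]
    · have hdvd : ¬ q ∣ p ^ m := fun h =>
        hpq ((Nat.prime_dvd_prime_iff_eq hq.out hp).1 (hq.out.dvd_of_dvd_pow h))
      have hdvd' : ¬ p ∣ q := fun h => hpq ((Nat.prime_dvd_prime_iff_eq hp hq.out).1 h).symm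
      have hcard : (((Ideal.span {(p : ℤ)}).primesOver (𝓞 K)).ncard : ℝ) *
          orderOf (p : ZMod q) = (q : ℝ) - 1 := by
        have : IsGalois ℚ K := IsCyclotomicExtension.isGalois {q} ℚ K
        have h1 := Ideal.ncard_primesOver_mul_ramificationIdxIn_mul_inertiaDegIn
          (Ideal.span {(p : ℤ)}) (𝓞 K) Gal(K/ℚ)
        rw [IsCyclotomicExtension.Rat.ramificationIdxIn_eq_of_not_dvd p K hdvd',
          IsCyclotomicExtension.Rat.inertiaDegIn_eq_of_not_dvd p K hdvd', one_mul,
          IsGalois.card_aut_eq_finrank, IsCyclotomicExtension.Rat.finrank q K,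
          Nat.totient_prime hq.out] at h1
        rw [← Nat.cast_mul, h1, Nat.cast_sub hq.out.one_le, Nat.cast_one]
      rw [if_neg hdvd, idealVonMangoldt_prime_pow (f := orderOf (p : ZMod q)) hp hm.ne'
        (orderOf_pos_of_ne hp (Ne.symm hpq)).ne']
      · simp only [orderOf_dvd_iff_pow_eq_one, Nat.cast_pow]
        split_ifs
        · rw [← mul_assoc, hcard]
        · rw [mul_zero]
      · intro P hP
        have hP' : P ∈ (Ideal.span {(p : ℤ)}).primesOver (𝓞 K) := by
          rw [← coe_primesDividing_prime_pow hp hm.ne']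
          exact hP
        have := hP'.1
        have := hP'.2
        rw [← Ideal.pow_inertiaDeg p P,
          IsCyclotomicExtension.Rat.inertiaDeg_eq_of_not_dvd p K P hdvd']
  · rw [idealVonMangoldt_of_not_isPrimePow hn hpp, vonMangoldt_eq_zero_iff.2 hpp]
    simp

end

/-! ### The Dedekind zeta function of a cyclotomic field -/

section

open NumberField DirichletCharacter LSeries

section dirichletSeries

variable (K : Type*) [Field K] [NumberField K]

theorem abscissaOfAbsConv_card_ideal_le :
    abscissaOfAbsConv (fun n => (Nat.card {I : Ideal (𝓞 K) // Ideal.absNorm I = n} : ℂ)) ≤ 1 := by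
  refine abscissaOfAbsConv_le_of_forall_lt_LSeriesSummable (x := 1) fun y hy => ?_
  have h := LSeriesSummable_of_sum_norm_bigO_and_nonneg (r := 1) (s := (y : ℂ))
    (f := fun n => (Nat.card {I : Ideal (𝓞 K) // Ideal.absNorm I = n} : ℝ)) ?_
    (fun _ => Nat.cast_nonneg _) zero_le_one (by simpa using hy)
  · simpa using h
  refine Asymptotics.isBigO_atTop_natCast_rpow_of_tendsto_div_rpow (a := dedekindZeta_residue K) ?_
  refine ((Ideal.tendsto_norm_le_div_atTop₀ K).comp tendsto_natCast_atTop_atTop).congr fun n => ?_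
  simp only [Function.comp_apply, Nat.cast_le, ← Nat.cast_sum, Real.rpow_one]
  congr
  rw [← add_left_inj 1, ← Ideal.card_norm_le_eq_card_norm_le_add_one,
    show Finset.Icc 1 n = Finset.Ioc 0 n from Finset.Icc_succ_left_eq_Ioc _ _,
    show 1 = Nat.card {I : Ideal (𝓞 K) // Ideal.absNorm I = 0} by
      simp [Ideal.absNorm_eq_zero_iff],
    Finset.sum_Ioc_add_eq_sum_Icc (n.zero_le),
    ← Finset.card_preimage_eq_sum_card_image_eq
      (fun k _ => Ideal.finite_setOfPred_absNorm_eq k)]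
  simp [Set.coe_eq_subtype]

/-- The identity `-ζ_K' = ζ_K · ∑ Λ_K(n) n⁻ˢ`, with `Λ_K = idealVonMangoldt K`. -/
theorem hasDerivAt_dedekindZeta {s : ℂ} (hs : 1 < s.re)
    (hΛ : LSeriesSummable (fun n => (idealVonMangoldt K n : ℂ)) s) :
    HasDerivAt (dedekindZeta K)
      (-(dedekindZeta K s * LSeries (fun n => (idealVonMangoldt K n : ℂ)) s)) s := by
  have ha : abscissaOfAbsConv
      (fun n => (Nat.card {I : Ideal (𝓞 K) // Ideal.absNorm I = n} : ℂ)) < s.re :=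
    (abscissaOfAbsConv_card_ideal_le K).trans_lt (by exact_mod_cast hs)
  have h := LSeries_hasDerivAt ha
  have hsum := LSeriesSummable_of_abscissaOfAbsConv_lt_re ha
  rw [dedekindZeta, ← LSeries_convolution' hsum hΛ]
  refine h.congr_deriv (congrArg Neg.neg (LSeries_congr (fun {n} hn => ?_) s))
  rw [convolution_def, logMul, ← Complex.natCast_log]
  have := log_mul_card_idealsOfNorm (K := K) hn
  simp only [card_idealsOfNorm] at this
  simp only
  exact_mod_cast this

end dirichletSeries

variable (q : ℕ) [hq : Fact q.Prime]

open scoped Classical in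
/-- The entire function `(s - 1) ζ(s) ∏_{χ ≠ 1} L(s, χ)`, the product being over the nontrivial
characters modulo `q`. It is a constant multiple of `(s - 1) ζ_K(s)` for the cyclotomic
field `K` of conductor `q`. -/
noncomputable def zetaProduct (s : ℂ) : ℂ :=
  LFunctionTrivChar₁ 1 s * ∏ χ ∈ ({1}ᶜ : Finset (DirichletCharacter ℂ q)), LFunction χ s

theorem differentiable_zetaProduct : Differentiable ℂ (zetaProduct q) := by
  unfold zetaProduct
  refine (differentiable_LFunctionTrivChar₁ 1).mul (Differentiable.fun_finsetProd fun χ hχ => ?_)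
  exact differentiable_LFunction (by simpa using hχ)

theorem LFunctionTrivChar₁_one_ne_zero {s : ℂ} (hs : 1 ≤ s.re) : LFunctionTrivChar₁ 1 s ≠ 0 := by
  rcases eq_or_ne s 1 with rfl | hs1
  · exact LFunctionTrivChar₁_apply_one_ne_zero 1
  · rw [LFunctionTrivChar₁, Function.update_of_ne hs1]
    exact mul_ne_zero (sub_ne_zero.2 hs1) (LFunction_ne_zero_of_one_le_re _ (.inr hs1) hs)

theorem LFunction_ne_zero_of_ne_one {χ : DirichletCharacter ℂ q} (hχ : χ ≠ 1) {s : ℂ}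
    (hs : 1 ≤ s.re) : LFunction χ s ≠ 0 :=
  LFunction_ne_zero_of_one_le_re χ (.inl hχ) hs

theorem zetaProduct_ne_zero {s : ℂ} (hs : 1 ≤ s.re) : zetaProduct q s ≠ 0 := by
  refine mul_ne_zero (LFunctionTrivChar₁_one_ne_zero hs) (Finset.prod_ne_zero_iff.2 fun χ hχ => ?_)
  exact LFunction_ne_zero_of_ne_one q (by simpa using hχ) hs

open scoped Classical in
theorem logDeriv_zetaProduct {s : ℂ} (hs : 1 ≤ s.re) :
    logDeriv (zetaProduct q) s = deriv (LFunctionTrivChar₁ 1) s / LFunctionTrivChar₁ 1 s +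
      ∑ χ ∈ ({1}ᶜ : Finset (DirichletCharacter ℂ q)), deriv (LFunction χ) s / LFunction χ s := by
  have hd : ∀ χ ∈ ({1}ᶜ : Finset (DirichletCharacter ℂ q)),
      DifferentiableAt ℂ (LFunction χ) s := fun χ hχ =>
    (differentiable_LFunction (by simpa using hχ)).differentiableAt
  have h0 : ∀ χ ∈ ({1}ᶜ : Finset (DirichletCharacter ℂ q)), LFunction χ s ≠ 0 := fun χ hχ =>
    LFunction_ne_zero_of_ne_one q (by simpa using hχ) hs
  have h := logDeriv_mul (f := LFunctionTrivChar₁ 1)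
    (g := fun s => ∏ χ ∈ ({1}ᶜ : Finset (DirichletCharacter ℂ q)), LFunction χ s) s
    (LFunctionTrivChar₁_one_ne_zero hs) (Finset.prod_ne_zero_iff.2 h0)
    (differentiable_LFunctionTrivChar₁ 1).differentiableAt (DifferentiableAt.fun_finsetProd hd)
  rw [logDeriv_prod h0 hd] at h
  exact h

theorem logDeriv_zetaProduct_one :
    logDeriv (zetaProduct q) 1 = Real.eulerMascheroniConstant + sumLogDerivOne q := by
  rw [logDeriv_zetaProduct q (by simp), hasDerivAt_LFunctionTrivChar₁_one.deriv,
    LFunctionTrivChar₁_one_apply_one, div_one]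
  rfl

variable (K : Type*) [Field K] [NumberField K] [IsCyclotomicExtension {q} ℚ K]

open scoped Classical in
/-- The splitting law of `idealVonMangoldt_cyclotomic`, rewritten with the orthogonality
of characters. -/
theorem idealVonMangoldt_eq_sum {n : ℕ} (hn : n ≠ 0) :
    (idealVonMangoldt K n : ℂ) = ArithmeticFunction.vonMangoldt n +
      ∑ χ ∈ ({1}ᶜ : Finset (DirichletCharacter ℂ q)),
        χ n * ArithmeticFunction.vonMangoldt n := by
  have hsum := sum_characters_eq ℂ (n : ZMod q)
  rw [← Finset.sum_add_sum_compl {(1 : DirichletCharacter ℂ q)}, Finset.sum_singleton,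
    Nat.totient_prime hq.out, Nat.cast_sub hq.out.one_le, Nat.cast_one] at hsum
  rw [← Finset.sum_mul, idealVonMangoldt_cyclotomic (q := q) hn]
  rw [← eq_sub_iff_add_eq'] at hsum
  rw [hsum]
  by_cases hd : q ∣ n
  · have h0 : (n : ZMod q) = 0 := (ZMod.natCast_eq_zero_iff n q).2 hd
    rw [if_pos hd, h0, if_neg zero_ne_one, MulChar.map_zero]
    simp
  · have hu : IsUnit (n : ZMod q) := by
      rw [isUnit_iff_ne_zero, Ne, ZMod.natCast_eq_zero_iff]
      exact hd
    rw [if_neg hd, MulChar.one_apply hu]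
    split_ifs
    · push_cast
      ring
    · simp

theorem LSeriesHasSum_idealVonMangoldt {s : ℂ} (hs : 1 < s.re) :
    LSeriesHasSum (fun n => (idealVonMangoldt K n : ℂ)) s
      (1 / (s - 1) - logDeriv (zetaProduct q) s) := by
  classical
  have hs1 : s ≠ 1 := by
    rintro rfl
    simp at hs
  have hζ : riemannZeta s ≠ 0 := riemannZeta_ne_zero_of_one_lt_re hs
  have h1 := (ArithmeticFunction.LSeriesSummable_vonMangoldt hs).LSeriesHasSum
  rw [ArithmeticFunction.LSeries_vonMangoldt_eq_deriv_riemannZeta_div hs] at h1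
  have h2 : ∀ χ ∈ ({1}ᶜ : Finset (DirichletCharacter ℂ q)),
      LSeriesHasSum (fun n => χ n * ArithmeticFunction.vonMangoldt n) s
        (-deriv (LFunction χ) s / LFunction χ s) := by
    intro χ _
    have h := (LSeriesSummable_twist_vonMangoldt χ hs).LSeriesHasSum
    rw [LSeries_twist_vonMangoldt_eq χ hs, ← deriv_LFunction_eq_deriv_LSeries χ hs,
      ← LFunction_eq_LSeries χ hs] at h
    exact h
  have h3 := h1.add (LSeriesHasSum.sum h2)
  have hval : 1 / (s - 1) - logDeriv (zetaProduct q) s = -deriv riemannZeta s / riemannZeta s +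
      ∑ χ ∈ ({1}ᶜ : Finset (DirichletCharacter ℂ q)),
        -deriv (LFunction χ) s / LFunction χ s := by
    rw [logDeriv_zetaProduct q hs.le, deriv_LFunctionTrivChar₁_apply_of_ne_one _ hs1,
      LFunctionTrivChar₁, Function.update_of_ne hs1]
    simp only [neg_div, Finset.sum_neg_distrib]
    have hT : LFunctionTrivChar 1 = riemannZeta := LFunction_modOne_eq
    rw [hT]
    have := sub_ne_zero.2 hs1
    field_simp
    ring
  rw [hval]
  refine (LSeriesHasSum_congr s _ fun {n} hn => ?_).2 h3
  rw [idealVonMangoldt_eq_sum q K hn]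
  simp

/-- The factorisation of the Dedekind zeta function of the cyclotomic field of prime conductor `q`,
up to a constant factor: both sides have the same logarithmic derivative. -/
theorem exists_dedekindZeta_eq_mul_zetaProduct :
    ∃ c : ℂ, ∀ s : ℂ, 1 < s.re → (s - 1) * dedekindZeta K s = c * zetaProduct q s := by
  have hopen : IsOpen {s : ℂ | 1 < s.re} := isOpen_lt continuous_const Complex.continuous_re
  have hconv : Convex ℝ {s : ℂ | 1 < s.re} := convex_halfSpace_re_gt 1
  have hder : ∀ s ∈ {s : ℂ | 1 < s.re},
      HasDerivAt (fun s => (s - 1) * dedekindZeta K s / zetaProduct q s) 0 s := by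
    intro s hs
    have hsum := LSeriesHasSum_idealVonMangoldt q K hs
    have h1 := hasDerivAt_dedekindZeta K hs hsum.LSeriesSummable
    have hP := zetaProduct_ne_zero q (le_of_lt hs)
    have hs1 : s - 1 ≠ 0 := by
      intro h
      rw [sub_eq_zero.1 h] at hs
      simp at hs
    refine ((((hasDerivAt_id s).sub_const 1).mul h1).div
      (differentiable_zetaProduct q s).hasDerivAt hP).congr_deriv ?_
    rw [hsum.LSeries_eq, logDeriv_apply]
    simp only [id, Pi.mul_apply]
    field_simp
    ring
  obtain ⟨c, hc⟩ := hopen.exists_is_const_of_deriv_eq_zero (𝕜 := ℂ) hconv.isPreconnected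
    (fun s hs => (hder s hs).differentiableAt.differentiableWithinAt)
    (fun s hs => (hder s hs).deriv)
  refine ⟨c, fun s hs => ?_⟩
  rw [← hc s hs, div_mul_cancel₀ _ (zetaProduct_ne_zero q (le_of_lt hs))]

/-- The Euler–Kronecker constant of the cyclotomic field of conductor `q`. -/
theorem isEulerKronecker_cyclotomic {c : ℝ}
    (hc : (c : ℂ) = Real.eulerMascheroniConstant + sumLogDerivOne q) : IsEulerKronecker K c := by
  obtain ⟨a, ha⟩ := exists_dedekindZeta_eq_mul_zetaProduct q K
  have hα0 := dedekindZeta_residue_ne_zero K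
  have hα : (dedekindZeta_residue K : ℂ) = a * zetaProduct q 1 := by
    have hr : Tendsto (fun s : ℝ => (s : ℂ)) (𝓝[>] 1) (𝓝 1) := by
      have := (Complex.continuous_ofReal.tendsto 1).mono_left
        (nhdsWithin_le_nhds (s := Set.Ioi (1 : ℝ)))
      simpa using this
    refine tendsto_nhds_unique (tendsto_sub_one_mul_dedekindZeta_nhdsGT K) ?_
    refine (((differentiable_zetaProduct q).continuous.tendsto 1).comp hr |>.const_mul a).congr' ?_
    filter_upwards [self_mem_nhdsWithin] with s hs
    exact (ha s (by simpa using hs)).symm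
  have hd : Differentiable ℂ fun s => a * zetaProduct q s :=
    (differentiable_zetaProduct q).const_mul a
  -- the regular part of `ζ_K` is the difference quotient at `1` of the entire function
  -- `(s - 1) ζ_K(s)`
  refine ⟨dedekindZeta_residue K, dedekindZeta_residue K * c, ⟨hα0,
    dslope (fun s => a * zetaProduct q s) 1, ?_, ?_, ?_⟩, by field_simp⟩
  · refine Differentiable.analyticAt (fun s => ?_) 1
    have := (Complex.differentiableOn_dslope (s := Set.univ) (c := 1) univ_mem).2
      hd.differentiableOn
    exact this.differentiableAt univ_mem
  · rw [dslope_same, deriv_const_mul _ (differentiable_zetaProduct q 1), Complex.ofReal_mul, hα, hc,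
      ← logDeriv_zetaProduct_one q, logDeriv_apply]
    have := zetaProduct_ne_zero q (s := 1) (by simp)
    field_simp
  · filter_upwards [self_mem_nhdsWithin] with s hs
    have hs1 : s ≠ 1 := by
      rintro rfl
      simp at hs
    have := sub_ne_zero.2 hs1
    rw [dslope_of_ne _ hs1, slope_def_field, ← ha s hs, hα]
    field_simp
    ring

end

/-! ### The constant term -/

theorem theorem4 (q : ℕ) [Fact q.Prime] (hq : Odd q) :
    ∃ B EK : ℝ,
      Tendsto (fun x : ℝ => vonMangoldtSum q x - ((q : ℝ) - 2) / ((q : ℝ) - 1) * Real.log x)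
        atTop (𝓝 B) ∧
      IsEulerKronecker (CyclotomicField q ℚ) EK ∧
      Summable (fun p : NonSplitPrime q => primeTerm q p) ∧
      B = (3 - (q : ℝ)) * Real.log q / (((q : ℝ) - 1) * ((q : ℝ) ^ 2 - 1))
          - Real.eulerMascheroniConstant + EK / ((q : ℝ) - 1)
          + ∑' p : NonSplitPrime q, primeTerm q p ∧
      ∀ (g : (ZMod q)ˣ) (hg : ∀ x, x ∈ Subgroup.zpowers g),
        (B : ℂ) =
          (((3 - (q : ℝ)) * Real.log q / (((q : ℝ) - 1) * ((q : ℝ) ^ 2 - 1))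
            - ((q : ℝ) - 2) / ((q : ℝ) - 1) * Real.eulerMascheroniConstant : ℝ) : ℂ)
          + 1 / ((q : ℂ) - 1) * ∑ k ∈ Finset.Icc 1 (q - 2),
              deriv (DirichletCharacter.LFunction (primitiveRootChar q g hg ^ k)) 1 /
                DirichletCharacter.LFunction (primitiveRootChar q g hg ^ k) 1
          + ((∑' p : NonSplitPrime q, primeTerm q p : ℝ) : ℂ) := by
  obtain ⟨T, hT⟩ : ∃ T : ℝ, T = ∑' p : NonSplitPrime q, primeTerm q p := ⟨_, rfl⟩
  have hq1 : (q : ℝ) - 1 ≠ 0 := by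
    have : (1 : ℝ) < q := by exact_mod_cast (Fact.out : q.Prime).one_lt
    linarith
  have hq1' : (q : ℂ) - 1 ≠ 0 := by exact_mod_cast hq1
  have hlim := tendsto_vonMangoldtSum_complex (q := q)
  rw [← hT] at hlim ⊢
  -- a limit of real numbers is real
  have hre := (Complex.continuous_re.tendsto _).comp hlim
  have hB := tendsto_nhds_unique ((Complex.continuous_ofReal.tendsto _).comp hre) hlim
  simp only [Function.comp_def, Complex.ofReal_re] at hre
  set B : ℝ := Complex.re _ with hBdef
  set A : ℝ := (3 - (q : ℝ)) * Real.log q / (((q : ℝ) - 1) * ((q : ℝ) ^ 2 - 1)) with hA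
  set γ := Real.eulerMascheroniConstant with hγ
  -- so the sum over the characters is real as well, and `EK` is `γ` plus that sum
  have hS : sumLogDerivOne q =
      ((((q : ℝ) - 1) * (B - (A - ((q : ℝ) - 2) / ((q : ℝ) - 1) * γ) - T) : ℝ) : ℂ) := by
    push_cast
    rw [hB]
    push_cast
    field_simp
    ring
  -- the canonical `ℚ`-algebra structure agrees with the one of the splitting field
  have hcyc : @IsCyclotomicExtension {q} ℚ (CyclotomicField q ℚ) _ _ DivisionRing.toRatAlgebra := by
    convert! CyclotomicField.isCyclotomicExtension q ℚ
  refine ⟨B, γ + ((q : ℝ) - 1) * (B - (A - ((q : ℝ) - 2) / ((q : ℝ) - 1) * γ) - T), hre,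
    isEulerKronecker_cyclotomic q (CyclotomicField q ℚ) ?_, summable_primeTerm, ?_, fun g hg => ?_⟩
  · rw [hS, Complex.ofReal_add]
  · field_simp
    ring
  · rw [hB, sumLogDerivOne_eq_sum_pow q g hg]
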